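/- Let $n,m\ge 1$ be integers and $\alpha>0$. A smooth function $f\colon\mathbb{C}^n\to\mathbb{C}$ is called $m$-analytic if $\overline{D}^k f=0$ for every multi-index $k\in\mathbb{N}_0^n$ with $|k|=k_1+\dots+k_n=m$, where $\overline{D}^k=\partial_{\overline z_1}^{k_1}\cdots\partial_{\overline z_n}^{k_n}$. Let $\mathcal{F}_{\alpha,m}$ be the space of all $m$-analytic functions on $\mathbb{C}^n$ with $\int_{\mathbb{C}^n}|f(z)|^2 e^{-\alpha|z|^2}\,dz<\infty$. Let $\mathcal{H}_m$ be the space of all functions on $\mathbb{R}^n\times\mathbb{R}^n$ of the form $$(x,y)\mapsto 2^{n/2}\,e^{-\frac12|x|^2-\frac12|y|^2-i\langle x,y\rangle}\,f\!\left(\frac{x+iy}{\sqrt{\alpha}}\right),\qquad f\in\mathcal{F}_{\alpha,m},$$ with the inner product $\langle g,h\rangle=(2\pi)^{-n}\int_{\mathbb{R}^{2n}} g\,\overline{h}\,dx\,dy$. Then $\mathcal{H}_m$ has a unique reproducing kernel, that is, a unique family $(K_{x,y})_{x,y\in\mathbb{R}^n}$ in $\mathcal{H}_m$ with $g(x,y)=\langle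 g,K_{x,y}\rangle$ for all $g\in\mathcal{H}_m$ and $x,y\in\mathbb{R}^n$. For all $\xi,y,v\in\mathbb{R}^n$, the function $u\mapsto K_{0,y}(u,v)e^{-i\langle u,\xi\rangle}$ is Lebesgue integrable on $\mathbb{R}^n$, and $$L_{\xi,y}(v):=\frac{1}{(2\pi)^{n/2}}\int_{\mathbb{R}^n}K_{0,y}(u,v)\,e^{-i\langle u,\xi\rangle}\,du$$ satisfies $$L_{\xi,y}(v)=\sum_{k\in J_{n,m}}\overline{q_{k,\xi}(y)}\,q_{k,\xi}(v)=\sum_{k\in J_{n,m}}q_{k,\xi}(y)\,q_{k,\xi}(v),$$ where $J_{n,m}=\{k\in\mathbb{N}_0^n\colon |k|\le m-1\}$ is a set with $d=\binom{n+m-1}{n}$ elements, $$q_{k,\xi}(v)=2^{n/2}\pi^{n/4}\prod_{r=1}^n\psi_{k_r}\!\left(\frac{\xi_r+2v_r}{\sqrt2}\right),$$ and $\psi_j(t)=(2^j\,j!\,\sqrt{\pi})^{-1/2}e^{-t^2/2}H_j(t)$ are the Hermite functions, with $H_j$ the physicists' Hermite polynomials. -/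

import Mathlib

open MeasureTheory Complex
open scoped ComplexConjugate ContDiff

noncomputable section

namespace PolyFock

/-- The Wirtinger derivative `∂f/∂z̄_r = (∂f/∂x_r + i ∂f/∂y_r) / 2` on `ℂⁿ`. -/
def dbar {n : ℕ} (r : Fin n) (f : (Fin n → ℂ) → ℂ) : (Fin n → ℂ) → ℂ := fun z =>
  (1 / 2 : ℂ) * (fderiv ℝ f z (Pi.single r 1) + I * fderiv ℝ f z (Pi.single r I))

/-- The iterated Wirtinger derivative `D̄ᵏ` for a multi-index `k`: each `∂/∂z̄_r` is applied
`k r` times. -/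
def dbarPow {n : ℕ} (k : Fin n → ℕ) (f : (Fin n → ℂ) → ℂ) : (Fin n → ℂ) → ℂ :=
  (List.finRange n).foldr (fun r g => (dbar r)^[k r] g) f

/-- Homogeneously `m`-analytic functions: smooth functions on `ℂⁿ` with `D̄ᵏ f = 0` for all
multi-indices `k` with `|k| = m`. -/
def IsPolyanalytic {n : ℕ} (m : ℕ) (f : (Fin n → ℂ) → ℂ) : Prop :=
  ContDiff ℝ ∞ f ∧ ∀ k : Fin n → ℕ, ∑ r, k r = m → ∀ z, dbarPow k f z = 0

/-- The `m`-analytic Bargmann-Segal-Fock space over `ℂⁿ`: `m`-analytic functions that are square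
integrable with respect to the Gaussian weight `exp (-α |z|²)`, where `|z|` is the Euclidean
norm. -/
def fockSpace (n m : ℕ) (α : ℝ) : Set ((Fin n → ℂ) → ℂ) :=
  {f | IsPolyanalytic m f ∧
    Integrable (fun z : Fin n → ℂ => ‖f z‖ ^ 2 * Real.exp (-α * ∑ r, ‖z r‖ ^ 2)) volume}

/-- The flattening operator
`f ↦ 2^{n/2} exp (-|x|²/2 - |y|²/2 - i⟨x,y⟩) f ((x + i y) / √α)`. -/
def flatten (n : ℕ) (α : ℝ) (f : (Fin n → ℂ) → ℂ) : (Fin n → ℝ) × (Fin n → ℝ) → ℂ := fun p =>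
  (((2 : ℝ) ^ ((n : ℝ) / 2) : ℝ) : ℂ) *
    cexp (-(1 / 2 : ℂ) * ∑ r, (p.1 r : ℂ) ^ 2 - (1 / 2 : ℂ) * ∑ r, (p.2 r : ℂ) ^ 2
      - I * ∑ r, (p.1 r : ℂ) * (p.2 r : ℂ)) *
    f (fun r => ((p.1 r : ℂ) + I * (p.2 r : ℂ)) / ((√α : ℝ) : ℂ))

/-- The flattened space: the image of the Fock space under the flattening operator. -/
def flatSpace (n m : ℕ) (α : ℝ) : Set ((Fin n → ℝ) × (Fin n → ℝ) → ℂ) :=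
  flatten n α '' fockSpace n m α

/-- The inner product of `L²(ℝ²ⁿ)` with respect to Lebesgue measure multiplied by `(2π)⁻ⁿ`. -/
def flatInner {n : ℕ} (f g : (Fin n → ℝ) × (Fin n → ℝ) → ℂ) : ℂ :=
  ((((2 * Real.pi) ^ n)⁻¹ : ℝ) : ℂ) * ∫ p, f p * conj (g p)

/-- `K` is a reproducing kernel of the space of functions `H` with inner product `ip` (linear in
its first argument): all `K x` lie in `H`, and `f x = ⟨f, K x⟩` for all `f` in `H`. -/
def IsReproducingKernel {X : Type*} (H : Set (X → ℂ)) (ip : (X → ℂ) → (X → ℂ) → ℂ)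
    (K : X → X → ℂ) : Prop :=
  ∀ x, K x ∈ H ∧ ∀ f ∈ H, f x = ip f (K x)

/-- The integrand `u ↦ K_{0,y}(u,v) exp (-i⟨u,ξ⟩)` of the horizontal Fourier transform. -/
def horizontalIntegrand {n : ℕ}
    (K : (Fin n → ℝ) × (Fin n → ℝ) → (Fin n → ℝ) × (Fin n → ℝ) → ℂ)
    (ξ y v u : Fin n → ℝ) : ℂ :=
  K (0, y) (u, v) * cexp (-I * ∑ r, (u r : ℂ) * (ξ r : ℂ))

/-- The horizontal Fourier transform
`L_{ξ,y}(v) = (2π)^{-n/2} ∫ K_{0,y}(u,v) exp (-i⟨u,ξ⟩) du`. -/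
def horizontalFourier {n : ℕ}
    (K : (Fin n → ℝ) × (Fin n → ℝ) → (Fin n → ℝ) × (Fin n → ℝ) → ℂ)
    (ξ y v : Fin n → ℝ) : ℂ :=
  (((2 * Real.pi) ^ (-(n : ℝ) / 2) : ℝ) : ℂ) * ∫ u, horizontalIntegrand K ξ y v u

/-- The physicists' Hermite polynomials `H₀ = 1`, `H_{j+1} = 2 X H_j - H_j'`. -/
def physHermite : ℕ → Polynomial ℝ
  | 0 => 1
  | j + 1 => 2 * Polynomial.X * physHermite j - Polynomial.derivative (physHermite j)

/-- The Hermite functions `ψ_j(t) = (2^j j! √π)^{-1/2} exp (-t²/2) H_j(t)`. -/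
def hermiteFun (j : ℕ) (t : ℝ) : ℝ :=
  ((2 : ℝ) ^ j * (j.factorial : ℝ) * √Real.pi) ^ (-(1 / 2 : ℝ)) *
    Real.exp (-(1 / 2) * t ^ 2) * (physHermite j).eval t

/-- `q_{k,ξ}(v) = 2^{n/2} π^{n/4} ∏_r ψ_{k_r}((ξ_r + 2 v_r)/√2)`, as a complex number. -/
def q {n : ℕ} (k : Fin n → ℕ) (ξ v : Fin n → ℝ) : ℂ :=
  (((2 : ℝ) ^ ((n : ℝ) / 2) * Real.pi ^ ((n : ℝ) / 4) *
    ∏ r, hermiteFun (k r) ((ξ r + 2 * v r) / √2) : ℝ) : ℂ)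

/-- The set of multi-indices `k ∈ ℕ₀ⁿ` with `|k| ≤ m - 1`, for `m ≥ 1`. -/
def multiIndices (n m : ℕ) : Finset (Fin n → ℕ) :=
  (Fintype.piFinset fun _ : Fin n => Finset.range m).filter fun k => ∑ r, k r ≤ m - 1

theorem mem_multiIndices {n m : ℕ} (hm : 1 ≤ m) (k : Fin n → ℕ) :
    k ∈ multiIndices n m ↔ ∑ r, k r ≤ m - 1 := by
  simp only [multiIndices, Finset.mem_filter, Fintype.mem_piFinset, Finset.mem_range,
    and_iff_right_iff_imp]
  intro h r
  have := Finset.single_le_sum (f := k) (fun i _ => Nat.zero_le (k i)) (Finset.mem_univ r)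
  omega

end PolyFock

end

/-! The kernel is found explicitly and its Fourier transform is then computed coordinate by
coordinate.

Rescaling by `√α` reduces to the weight `exp (-|w|²)`. Restricted to a complex line through the
origin, an `(M+1)`-analytic `G` is a polynomial of degree at most `M` in the conjugate variable with
entire coefficients (`DbarNil.exists_ray_decomposition`). By Cauchy's formula its mean over a circle
of radius `ρ` is then a polynomial in `ρ²` of degree at most `M` with constant term `G 0`. The
Laguerre polynomial `L_M^{(n)}` is orthogonal to the powers `s, …, s^M` for the radial weight, so
integrating `G` against `L_M^{(n)}(|w|²) exp (-|w|²)` gives `πⁿ G 0` (`DbarNil.integral_mul_lag`). A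
Weyl translation moves the origin to any `z` and yields the kernel `L_M^{(n)}(|w - z|²) exp ⟨w, z⟩`;
flattening transports it. Uniqueness needs only the Hermitian symmetry of the inner product.

With `M = m - 1`, the addition formula `sum_prod_lag` splits `L_{m-1}^{(n)}` of a sum of squares
into products of one-variable `L_{k_r}` over `|k| ≤ m - 1`, and the exponentials also factor over
coordinates. What remains is a one-dimensional integral of `L_j(u² + d²)` against a Gaussian wave.
It equals a product of two Hermite functions (`integral_gaussWave_mul_lag`), because the moments of
`(u + id)^a (u - id)^b` obey the recurrences that linearize Hermite products. -/

noncomputable section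

namespace PolyFock

/-! ### Laguerre polynomials: generating function, addition formula, orthogonality sum. -/

/-- The generalized Laguerre polynomial `L_M^{(a)}`, as a function on `ℝ`. -/
def lag (a M : ℕ) (s : ℝ) : ℝ :=
  ∑ i ∈ Finset.range (M + 1), (-1) ^ i * ((M + a).choose (a + i) : ℝ) / (i.factorial : ℝ) * s ^ i

/-- The power series `exp (-t X / (1 - X))`. -/
def expGen (t : ℝ) : PowerSeries ℝ :=
  PowerSeries.subst (PowerSeries.X * PowerSeries.mk (1 : ℕ → ℝ) : PowerSeries ℝ)
    (PowerSeries.rescale (-t) (PowerSeries.exp ℝ))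

theorem hasSubst_X_mul : PowerSeries.HasSubst
    (PowerSeries.X * PowerSeries.mk (1 : ℕ → ℝ) : PowerSeries ℝ) :=
  PowerSeries.HasSubst.of_constantCoeff_zero' (by simp)

theorem expGen_add (s t : ℝ) : expGen (s + t) = expGen s * expGen t := by
  unfold expGen
  rw [← PowerSeries.subst_mul hasSubst_X_mul, PowerSeries.exp_mul_exp_eq_exp_add, neg_add]

theorem expGen_zero : expGen 0 = 1 := by
  have h : PowerSeries.rescale (-(0 : ℝ)) (PowerSeries.exp ℝ) = 1 := by
    simp
  rw [expGen, h, ← PowerSeries.coe_substAlgHom hasSubst_X_mul, map_one]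

theorem expGen_sum {ι : Type*} (S : Finset ι) (t : ι → ℝ) :
    expGen (∑ r ∈ S, t r) = ∏ r ∈ S, expGen (t r) := by
  classical
  induction S using Finset.induction_on with
  | empty => simp [expGen_zero]
  | insert r S hr ih => rw [Finset.sum_insert hr, Finset.prod_insert hr, expGen_add, ih]

/-- `X / (1 - X)` has no constant term, so its `d`-th power starts in degree `d`. The cutoff `M` is
common to all `q ≤ M`, which lets the finite sum leave a Cauchy product. -/
theorem coeff_expGen_of_le (q M : ℕ) (h : q ≤ M) (t : ℝ) :
    PowerSeries.coeff q (expGen t) = ∑ d ∈ Finset.range (M + 1), (-t) ^ d / (d.factorial : ℝ) *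
      PowerSeries.coeff q ((PowerSeries.X * PowerSeries.mk (1 : ℕ → ℝ)) ^ d : PowerSeries ℝ) := by
  rw [expGen, PowerSeries.coeff_subst' hasSubst_X_mul, finsum_eq_sum_of_support_subset]
  · refine Finset.sum_congr rfl fun d _ => ?_
    simp [PowerSeries.coeff_exp, div_eq_mul_inv]
  · intro d hd
    by_contra hd'
    simp only [Finset.coe_range, Set.mem_Iio, not_lt] at hd'
    apply hd
    simp only [mul_pow]
    rw [PowerSeries.coeff_X_pow_mul', if_neg (by omega), smul_zero]

/-- This is the generating function `(1 - X)^{-(a+1)} exp (-tX/(1 - X))`: the `d`-th term of the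
exponential contributes `X^d (1 - X)^{-(a+d+1)}`, whose coefficients are binomial. -/
theorem coeff_expGen (a M : ℕ) (t : ℝ) :
    PowerSeries.coeff M ((PowerSeries.mk 1) ^ (a + 1) * expGen t) = lag a M t := by
  have h1 : PowerSeries.coeff M ((PowerSeries.mk 1) ^ (a + 1) * expGen t) =
      PowerSeries.coeff M ((PowerSeries.mk 1) ^ (a + 1) * ∑ d ∈ Finset.range (M + 1),
        PowerSeries.C ((-t) ^ d / (d.factorial : ℝ)) *
          (PowerSeries.X * PowerSeries.mk (1 : ℕ → ℝ)) ^ d : PowerSeries ℝ) := by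
    rw [PowerSeries.coeff_mul, PowerSeries.coeff_mul]
    refine Finset.sum_congr rfl fun p hp => ?_
    rw [coeff_expGen_of_le p.2 M (by rw [Finset.HasAntidiagonal.mem_antidiagonal] at hp; omega)]
    simp [PowerSeries.coeff_C_mul]
  rw [h1, Finset.mul_sum, map_sum, lag]
  refine Finset.sum_congr rfl fun d hd => ?_
  have h2 : (PowerSeries.mk 1) ^ (a + 1) * (PowerSeries.C ((-t) ^ d / (d.factorial : ℝ)) *
      (PowerSeries.X * PowerSeries.mk (1 : ℕ → ℝ)) ^ d) =
      PowerSeries.C ((-t) ^ d / (d.factorial : ℝ)) *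
        (PowerSeries.X ^ d * (PowerSeries.mk (1 : ℕ → ℝ)) ^ (a + d + 1)) := by ring
  simp only [Finset.mem_range] at hd
  rw [h2, PowerSeries.coeff_C_mul, PowerSeries.coeff_X_pow_mul', if_pos (by omega),
    PowerSeries.mk_one_pow_eq_mk_choose_add, PowerSeries.coeff_mk,
    show a + d + (M - d) = M + a by omega, neg_pow]
  ring

theorem coeff_mk_one_mul (M : ℕ) (f : PowerSeries ℝ) :
    PowerSeries.coeff M (PowerSeries.mk 1 * f) =
      ∑ j ∈ Finset.range (M + 1), PowerSeries.coeff j f := by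
  rw [mul_comm, PowerSeries.coeff_mul, Finset.Nat.sum_antidiagonal_eq_sum_range_succ_mk]
  simp

/-- Addition formula: multiplying `n` generating functions with `a = 0` adds the arguments and
produces `(1 - X)^{-n}`. The one further factor `1 / (1 - X)` needed for `L^{(n)}` sums all
coefficients up to degree `m - 1`. -/
theorem sum_prod_lag (n m : ℕ) (hm : 1 ≤ m) (t : Fin n → ℝ) :
    ∑ k ∈ multiIndices n m, ∏ r, lag 0 (k r) (t r) = lag n (m - 1) (∑ r, t r) := by
  rw [← coeff_expGen, pow_succ', mul_assoc, coeff_mk_one_mul, expGen_sum]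
  have h : (PowerSeries.mk (1 : ℕ → ℝ)) ^ n * ∏ r, expGen (t r)
      = ∏ r, ((PowerSeries.mk 1) ^ (0 + 1) * expGen (t r)) := by
    simp [Finset.prod_mul_distrib]
  rw [h]
  simp_rw [PowerSeries.coeff_prod, coeff_expGen]
  -- Grouping the multi-indices by `|k| = j` matches each fibre with the antidiagonal in the
  -- coefficient of the product.
  rw [← Finset.sum_fiberwise_of_maps_to (s := multiIndices n m) (t := Finset.range (m - 1 + 1))
    (g := fun k => ∑ r, k r)]
  · refine Finset.sum_congr rfl fun j hj => ?_
    refine Finset.sum_bij' (fun k _ => Finsupp.equivFunOnFinite.symm k) (fun l _ => ⇑l)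
      ?_ ?_ ?_ ?_ ?_
    · intro k hk
      simp only [Finset.mem_filter] at hk
      simp [Finset.mem_finsuppAntidiag, hk.2]
    · intro l hl
      simp only [Finset.mem_finsuppAntidiag] at hl
      simp only [Finset.mem_filter, mem_multiIndices hm]
      rw [hl.1]
      simp at hj
      exact ⟨by omega, rfl⟩
    · intro k hk; rfl
    · intro l hl; ext; rfl
    · intro k hk; rfl
  · intro k hk
    rw [mem_multiIndices hm] at hk
    simp
    omega

theorem lag_zero (a M : ℕ) : lag a M 0 = (M + a).choose a := by
  simp [lag, Finset.sum_range_succ']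

theorem card_multiIndices (n m : ℕ) (hm : 1 ≤ m) :
    (multiIndices n m).card = (n + m - 1).choose n := by
  have h := sum_prod_lag n m hm 0
  simp only [Pi.zero_apply, lag_zero, Finset.sum_const_zero] at h
  simp at h
  rw [show n + m - 1 = m - 1 + n by omega]
  exact_mod_cast h

/-- Compare coefficients of `X^M` in `(1 - X)^{-(n+a)} (1 - X)^{M+n} = (1 - X)^{M-a}`: the right
side has degree below `M` unless `a = 0`. This is the orthogonality of `L_M^{(n)}` to low powers in
combinatorial form. -/
theorem alternating_sum_choose_mul_choose (n M a : ℕ) (hn : 1 ≤ n) (ha : a ≤ M) :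
    ∑ i ∈ Finset.range (M + 1), (-1 : ℝ) ^ i * ((M + n).choose (n + i) : ℝ) *
      ((n + a - 1 + i).choose (n + a - 1) : ℝ) = if a = 0 then 1 else 0 := by
  have hc (N q : ℕ) : PowerSeries.coeff q ((1 - PowerSeries.X : PowerSeries ℝ) ^ N) =
      (-1) ^ q * (N.choose q : ℝ) := by
    have : (1 - PowerSeries.X : PowerSeries ℝ) ^ N = PowerSeries.rescale (-1)
        (((1 + Polynomial.X : Polynomial ℝ) ^ N : Polynomial ℝ) : PowerSeries ℝ) := by
      simp [PowerSeries.rescale_X, sub_eq_add_neg]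
    rw [this, PowerSeries.coeff_rescale, Polynomial.coeff_coe, Polynomial.coeff_one_add_X_pow]
  have h1 : (PowerSeries.mk (1 : ℕ → ℝ)) ^ (n + a - 1 + 1) * (1 - PowerSeries.X) ^ (M + n) =
      (1 - PowerSeries.X) ^ (M - a) := by
    rw [show M + n = (n + a - 1 + 1) + (M - a) by omega, pow_add _ _ (M - a), ← mul_assoc, ← mul_pow,
      PowerSeries.mk_one_mul_one_sub_eq_one, one_pow, one_mul]
  have h2 := congrArg (PowerSeries.coeff M) h1
  rw [PowerSeries.coeff_mul, Finset.Nat.sum_antidiagonal_eq_sum_range_succ_mk, hc,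
    PowerSeries.mk_one_pow_eq_mk_choose_add] at h2
  simp only [PowerSeries.coeff_mk, hc] at h2
  have h3 : ((M - a).choose M : ℝ) = if a = 0 then 1 else 0 := by
    split_ifs with h
    · simp [h]
    · rw [Nat.choose_eq_zero_of_lt (by omega)]; simp
  rw [h3] at h2
  have h4 : ∑ i ∈ Finset.range (M + 1), (-1 : ℝ) ^ i * ((M + n).choose (n + i) : ℝ) *
      ((n + a - 1 + i).choose (n + a - 1) : ℝ) = (-1) ^ M * ∑ i ∈ Finset.range (M + 1),
      ((n + a - 1 + i).choose (n + a - 1) : ℝ) * ((-1) ^ (M - i) * ((M + n).choose (M - i) : ℝ)) := by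
    rw [Finset.mul_sum]
    refine Finset.sum_congr rfl fun i hi => ?_
    simp only [Finset.mem_range] at hi
    rw [← Nat.choose_symm (show M - i ≤ M + n by omega), show M + n - (M - i) = n + i by omega]
    have : (-1 : ℝ) ^ M * (-1) ^ (M - i) = (-1) ^ i := by
      obtain ⟨j, rfl⟩ : ∃ j, M = i + j := ⟨M - i, by omega⟩
      rw [Nat.add_sub_cancel_left, pow_add, mul_assoc, ← mul_pow]; simp
    rw [← this]; ring
  rw [h4, h2, ← mul_assoc, ← mul_pow]; simp

/-! ### Hermite recurrences and linearization of products. -/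

theorem derivative_physHermite (j : ℕ) : Polynomial.derivative (physHermite (j + 1)) =
    2 * ((j : Polynomial ℝ) + 1) * physHermite j := by
  induction j with
  | zero => simp [physHermite]
  | succ j ih =>
    rw [physHermite, Polynomial.derivative_sub, ih, Polynomial.derivative_mul,
      Polynomial.derivative_mul, Polynomial.derivative_mul, ih]
    have h : physHermite (j + 1) = 2 * Polynomial.X * physHermite j -
      Polynomial.derivative (physHermite j) := rfl
    simp only [Polynomial.derivative_add, Polynomial.derivative_natCast, Polynomial.derivative_X,
      Polynomial.derivative_one, Polynomial.derivative_ofNat, Polynomial.derivative_mul]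
    push_cast
    rw [h]; ring

/-- The probabilists' Hermite polynomial evaluated at `x`. -/
def hermiteProb (j : ℕ) (x : ℝ) : ℝ := (√2)⁻¹ ^ j * (physHermite j).eval (x / √2)

theorem hermiteProb_zero (x : ℝ) : hermiteProb 0 x = 1 := by simp [hermiteProb, physHermite]

theorem hermiteProb_succ (j : ℕ) (x : ℝ) :
    hermiteProb (j + 1) x = x * hermiteProb j x - j * hermiteProb (j - 1) x := by
  have h2 : (√2)⁻¹ * (√2)⁻¹ = (1 / 2 : ℝ) := by
    rw [← mul_inv, Real.mul_self_sqrt (by norm_num)]; norm_num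
  rcases j with _ | j
  · simp [hermiteProb, physHermite]
    linear_combination (2 * x) * h2
  · simp only [hermiteProb]
    rw [physHermite, derivative_physHermite]
    simp only [Polynomial.eval_sub, Polynomial.eval_mul, Polynomial.eval_ofNat, Polynomial.eval_X,
      Polynomial.eval_add, Polynomial.eval_natCast, Polynomial.eval_one, Nat.add_sub_cancel]
    push_cast
    rw [div_eq_mul_inv]
    linear_combination (2 * x * (√2)⁻¹ ^ (j + 1) * (physHermite (j + 1)).eval (x * (√2)⁻¹)
      - 2 * (j + 1) * (√2)⁻¹ ^ j * (physHermite j).eval (x * (√2)⁻¹)) * h2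

/-- Abstract Hermite linearization, with `W` playing the role of the mixed Gaussian moments.
Truncated indices such as `a - 1` at `a = 0` are harmless since their coefficient vanishes. -/
theorem linearization_of_recurrence (W : ℕ → ℕ → ℂ) (A B : ℂ) (hA hB : ℕ → ℂ)
    (hA0 : hA 0 = 1) (hB0 : hB 0 = 1)
    (hA1 : ∀ j, hA (j + 1) = A * hA j - j * hA (j - 1))
    (hB1 : ∀ j, hB (j + 1) = B * hB j - j * hB (j - 1))
    (hWA : ∀ a b, W (a + 1) b = A * W a b - a * W (a - 1) b - b * W a (b - 1))
    (hWB : ∀ a b, W a (b + 1) = B * W a b - a * W (a - 1) b - b * W a (b - 1)) (j l : ℕ) :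
    ∑ i ∈ Finset.range (l + 1), (i.factorial * j.choose i * l.choose i : ℕ) * W (j - i) (l - i) =
      hA j * hB l * W 0 0 := by
  have h0 (l : ℕ) : W 0 l = hB l * W 0 0 := by
    induction l using Nat.strong_induction_on with
    | _ l ih =>
      rcases l with _ | l
      · simp [hB0]
      · rw [hWB, hB1, ih l (by omega)]
        rcases l with _ | l
        · simp [mul_assoc]
        · rw [ih (l + 1 - 1) (by omega)]; simp; ring
  induction j using Nat.strong_induction_on with
  | _ j ih =>
    rcases j with _ | j
    · rw [Finset.sum_range_succ']
      simp [h0 l, hA0]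
    · have key : ∑ i ∈ Finset.range (l + 1),
            ((i.factorial * (j + 1).choose i * l.choose i : ℕ) : ℂ) * W (j + 1 - i) (l - i) =
          A * (∑ i ∈ Finset.range (l + 1),
            ((i.factorial * j.choose i * l.choose i : ℕ) : ℂ) * W (j - i) (l - i)) -
          j * (∑ i ∈ Finset.range (l + 1),
            ((i.factorial * (j - 1).choose i * l.choose i : ℕ) : ℂ) * W (j - 1 - i) (l - i)) := by
        -- Multiplying by `A` splits the `i`-th term into contributions to the terms `i` and `i + 1`
        -- for `j + 1`; Pascal's rule then merges them.
        have e1 : ∀ i ∈ Finset.range (l + 1),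
            A * (((i.factorial * j.choose i * l.choose i : ℕ) : ℂ) * W (j - i) (l - i)) -
            j * (((i.factorial * (j - 1).choose i * l.choose i : ℕ) : ℂ) * W (j - 1 - i) (l - i)) =
            ((i.factorial * j.choose i * l.choose i : ℕ) : ℂ) * W (j + 1 - i) (l - i) +
            (((i + 1).factorial * j.choose i * l.choose (i + 1) : ℕ) : ℂ) *
              W (j - i) (l - (i + 1)) := by
          intro i hi
          have c1 : j * (j - 1).choose i = (j - i) * j.choose i := by
            rcases j with _ | j
            · simp
            · rw [Nat.add_sub_cancel, Nat.add_one_mul_choose_eq, Nat.choose_succ_right_eq, mul_comm]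
          have c2 : (i + 1) * l.choose (i + 1) = (l - i) * l.choose i := by
            rw [mul_comm, Nat.choose_succ_right_eq, mul_comm]
          rcases Nat.lt_or_ge j i with hij | hij
          · rw [Nat.choose_eq_zero_of_lt hij, Nat.choose_eq_zero_of_lt (show j - 1 < i by omega)]
            simp
          · have hw := hWA (j - i) (l - i)
            rw [show j - i + 1 = j + 1 - i by omega, show j - i - 1 = j - 1 - i by omega,
              show l - i - 1 = l - (i + 1) by omega] at hw
            have c1' : (j : ℂ) * ((j - 1).choose i : ℂ) = ((j - i : ℕ) : ℂ) * (j.choose i : ℂ) := by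
              exact_mod_cast c1
            have c2' : ((i : ℂ) + 1) * (l.choose (i + 1) : ℂ) =
                ((l - i : ℕ) : ℂ) * (l.choose i : ℂ) := by
              exact_mod_cast c2
            rw [hw, Nat.factorial_succ]
            push_cast
            linear_combination (-(i.factorial : ℂ) * (l.choose i : ℂ) * W (j - 1 - i) (l - i)) * c1'
              - (i.factorial : ℂ) * (j.choose i : ℂ) * W (j - i) (l - (i + 1)) * c2'
        rw [Finset.mul_sum, Finset.mul_sum, ← Finset.sum_sub_distrib, Finset.sum_congr rfl e1,
          Finset.sum_add_distrib, Finset.sum_range_succ', Finset.sum_range_succ',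
          Finset.sum_range_succ _ l]
        simp only [Nat.choose_succ_succ' j, Nat.choose_succ_self, Nat.add_sub_add_right,
          Nat.choose_zero_right, mul_zero, Nat.cast_zero, zero_mul, add_zero]
        rw [add_right_comm, ← Finset.sum_add_distrib]
        congr 1
        refine Finset.sum_congr rfl fun i _ => ?_
        push_cast; ring
      rw [key, ih j (by omega), hA1]
      rcases j with _ | j
      · simp [mul_assoc]
      · rw [ih (j + 1 - 1) (by omega)]; ring

/-! ### One-dimensional Gaussian Fourier integrals. -/

/-- The Gaussian factor `exp (-u²/2 - i u η)`. -/
def gaussWave (η u : ℝ) : ℂ := cexp (-(1 / 2 : ℂ) * (u : ℂ) ^ 2 - I * (u : ℂ) * (η : ℂ))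

theorem norm_gaussWave (η u : ℝ) : ‖gaussWave η u‖ = Real.exp (-(1 / 2) * u ^ 2) := by
  rw [gaussWave, Complex.norm_exp]
  congr 1
  simp [pow_two]

theorem integrable_gaussWave_mul_eval (η : ℝ) (p : Polynomial ℂ) :
    Integrable (fun u : ℝ => gaussWave η u * p.eval (u : ℂ)) := by
  induction p using Polynomial.induction_on' with
  | add p q hp hq =>
    simp only [Polynomial.eval_add, mul_add]
    exact hp.add hq
  | monomial k c =>
    have h : Integrable (fun u : ℝ => u ^ k * Real.exp (-(1 / 2) * u ^ 2)) := by
      have := integrable_rpow_mul_exp_neg_mul_sq (b := 1 / 2) (by norm_num) (s := k)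
        (by have : (0 : ℝ) ≤ k := by positivity
            linarith)
      simpa using this
    refine (h.norm.const_mul ‖c‖).mono' ?_ (Filter.Eventually.of_forall fun u => ?_)
    · unfold gaussWave
      exact Continuous.aestronglyMeasurable (by fun_prop)
    · rw [norm_mul, norm_gaussWave]
      simp
      apply le_of_eq; ring

theorem hasDerivAt_gaussWave (η u : ℝ) :
    HasDerivAt (gaussWave η) (-((u : ℂ) + I * η) * gaussWave η u) u := by
  have h1 : HasDerivAt (fun u : ℝ => (u : ℂ)) 1 u := Complex.ofRealCLM.hasDerivAt
  have h2 := (((h1.pow 2).const_mul (-(1 / 2 : ℂ))).sub ((h1.const_mul I).mul_const (η : ℂ))).cexp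
  refine h2.congr_deriv ?_
  simp only [gaussWave, Pi.pow_apply, Pi.sub_apply]
  push_cast
  ring

/-- The derivative of the Gaussian wave is `-(u + iη)` times itself, and the integral of a total
derivative vanishes. -/
theorem integral_gaussWave_by_parts (η : ℝ) (p : Polynomial ℂ) :
    ∫ u : ℝ, gaussWave η u * ((Polynomial.X + Polynomial.C (I * η)) * p).eval (u : ℂ) =
      ∫ u : ℝ, gaussWave η u * (Polynomial.derivative p).eval (u : ℂ) := by
  rw [← sub_eq_zero, ← integral_sub (integrable_gaussWave_mul_eval _ _)
    (integrable_gaussWave_mul_eval _ _), ← neg_eq_zero, ← integral_neg]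
  have hd (u : ℝ) : HasDerivAt (fun u : ℝ => gaussWave η u * p.eval (u : ℂ))
      (-(gaussWave η u * ((Polynomial.X + Polynomial.C (I * η)) * p).eval (u : ℂ) -
        gaussWave η u * (Polynomial.derivative p).eval (u : ℂ))) u := by
    refine ((hasDerivAt_gaussWave η u).mul
      ((p.hasDerivAt (u : ℂ)).comp_ofReal)).congr_deriv ?_
    simp only [Polynomial.eval_mul, Polynomial.eval_add, Polynomial.eval_X, Polynomial.eval_C]
    ring
  exact integral_eq_zero_of_hasDerivAt_of_integrable hd
    ((integrable_gaussWave_mul_eval _ _).sub (integrable_gaussWave_mul_eval _ _)).neg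
    (integrable_gaussWave_mul_eval _ _)

theorem integral_gaussWave (η : ℝ) :
    ∫ u : ℝ, gaussWave η u = ((√(2 * Real.pi) * Real.exp (-(1 / 2) * η ^ 2) : ℝ) : ℂ) := by
  have h := fourierIntegral_gaussian (b := 1 / 2) (by norm_num) (-(η : ℂ))
  have h1 (u : ℝ) : gaussWave η u = cexp (I * -(η : ℂ) * u) * cexp (-(1 / 2) * (u : ℂ) ^ 2) := by
    rw [gaussWave, ← Complex.exp_add]
    congr 1; ring
  simp only [h1]
  rw [h, Real.sqrt_eq_rpow]
  push_cast
  rw [Complex.ofReal_cpow (by positivity)]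
  push_cast
  congr 2 <;> ring

/-- The mixed moments `i^{a+b} ∫ (u + i d)^a (u - i d)^b exp (-u²/2 - i u η) du`. -/
def moment (η d : ℝ) (a b : ℕ) : ℂ :=
  I ^ (a + b) * ∫ u : ℝ, gaussWave η u *
    ((Polynomial.X + Polynomial.C (I * d)) ^ a * (Polynomial.X - Polynomial.C (I * d)) ^ b).eval
      (u : ℂ)

/-- Write `u + ic = (u + iη) - i(η - c)` and integrate the first part by parts. The power of `i` in
`moment` makes the coefficients real for real `c`; `c = d` and `c = -d` raise the first and the
second exponent. -/
theorem moment_raise (η d : ℝ) (a b : ℕ) (c : ℂ) :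
    I ^ (a + b + 1) * ∫ u : ℝ, gaussWave η u * ((Polynomial.X + Polynomial.C (I * c)) *
      ((Polynomial.X + Polynomial.C (I * d)) ^ a *
        (Polynomial.X - Polynomial.C (I * d)) ^ b)).eval (u : ℂ) =
    (η - c) * moment η d a b - a * moment η d (a - 1) b - b * moment η d a (b - 1) := by
  set P : Polynomial ℂ := Polynomial.X + Polynomial.C (I * d)
  set Q : Polynomial ℂ := Polynomial.X - Polynomial.C (I * d)
  have hsplit : (Polynomial.X + Polynomial.C (I * c)) * (P ^ a * Q ^ b) =
      (Polynomial.X + Polynomial.C (I * η)) * (P ^ a * Q ^ b) +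
        Polynomial.C (-I * (η - c)) * (P ^ a * Q ^ b) := by
    simp only [Polynomial.C_mul, Polynomial.C_sub, Polynomial.C_neg]; ring
  have hder : Polynomial.derivative (P ^ a * Q ^ b) =
      Polynomial.C (a : ℂ) * (P ^ (a - 1) * Q ^ b) +
        Polynomial.C (b : ℂ) * (P ^ a * Q ^ (b - 1)) := by
    simp [P, Q, Polynomial.derivative_mul, Polynomial.derivative_pow]; ring
  have hI (p : Polynomial ℂ) := integrable_gaussWave_mul_eval η p
  have hadd (p q : Polynomial ℂ) : ∫ u : ℝ, gaussWave η u * (p + q).eval (u : ℂ) =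
      (∫ u : ℝ, gaussWave η u * p.eval (u : ℂ)) + ∫ u : ℝ, gaussWave η u * q.eval (u : ℂ) := by
    rw [← integral_add (hI p) (hI q)]
    simp only [Polynomial.eval_add, mul_add]
  have hmul (c : ℂ) (q : Polynomial ℂ) : ∫ u : ℝ, gaussWave η u * (Polynomial.C c * q).eval (u : ℂ)
      = c * ∫ u : ℝ, gaussWave η u * q.eval (u : ℂ) := by
    rw [← integral_const_mul]
    simp only [Polynomial.eval_mul, Polynomial.eval_C, mul_left_comm]
  rw [hsplit, hadd, integral_gaussWave_by_parts, hder, hadd, hmul, hmul, hmul]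
  simp only [moment]
  have hI2 : I ^ 2 = -1 := I_sq
  have ha : I ^ (a + b + 1) * a = -a * I ^ (a - 1 + b) := by
    rcases a with _ | a
    · simp
    · rw [show a + 1 + b + 1 = (a + 1 - 1 + b) + 2 by omega, pow_add, hI2]; ring
  have hb : I ^ (a + b + 1) * b = -b * I ^ (a + (b - 1)) := by
    rcases b with _ | b
    · simp
    · rw [show a + (b + 1) + 1 = (a + (b + 1 - 1)) + 2 by omega, pow_add, hI2]; ring
  have hc : I ^ (a + b + 1) * (-I * (η - c)) = (η - c) * I ^ (a + b) := by
    rw [pow_succ]; linear_combination (-(η - c) * I ^ (a + b)) * hI2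
  linear_combination (∫ u : ℝ, gaussWave η u * (P ^ (a - 1) * Q ^ b).eval (u : ℂ)) * ha +
    (∫ u : ℝ, gaussWave η u * (P ^ a * Q ^ (b - 1)).eval (u : ℂ)) * hb +
    (∫ u : ℝ, gaussWave η u * (P ^ a * Q ^ b).eval (u : ℂ)) * hc

theorem moment_succ_left (η d : ℝ) (a b : ℕ) : moment η d (a + 1) b =
    ((η - d : ℝ) : ℂ) * moment η d a b - a * moment η d (a - 1) b - b * moment η d a (b - 1) := by
  have := moment_raise η d a b d
  push_cast
  rw [← this, moment]
  congr 2
  · ring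
  · simp only [pow_succ', mul_assoc]

theorem moment_succ_right (η d : ℝ) (a b : ℕ) : moment η d a (b + 1) =
    ((η + d : ℝ) : ℂ) * moment η d a b - a * moment η d (a - 1) b - b * moment η d a (b - 1) := by
  have := moment_raise η d a b (-d)
  push_cast
  rw [sub_neg_eq_add] at this
  rw [← this, moment]
  congr 2
  ext u
  congr 2
  simp only [pow_succ, mul_neg, Polynomial.C_neg]
  ring

theorem integrable_gaussWave_mul_lag (η d : ℝ) (j : ℕ) :
    Integrable (fun u : ℝ => gaussWave η u * ((lag 0 j (u ^ 2 + d ^ 2) : ℝ) : ℂ)) := by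
  have := integrable_gaussWave_mul_eval η (∑ i ∈ Finset.range (j + 1),
    Polynomial.C ((-1) ^ i * ((j + 0).choose (0 + i) : ℂ) / (i.factorial : ℂ)) *
      (Polynomial.X ^ 2 + Polynomial.C ((d : ℂ) ^ 2)) ^ i)
  refine this.congr (Filter.Eventually.of_forall fun u => ?_)
  simp [lag, Polynomial.eval_finsetSum]

/-- Since `u² + d² = (u + id)(u - id)`, the terms of `L_j` are diagonal moments, the sign `(-1)^i`
being absorbed as `i^{2i}` of the imaginary unit. Their sum is the linearization sum divided by
`j!`. -/
theorem integral_gaussWave_mul_lag (η d : ℝ) (j : ℕ) :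
    ∫ u : ℝ, gaussWave η u * ((lag 0 j (u ^ 2 + d ^ 2) : ℝ) : ℂ) =
      ((√(2 * Real.pi) * Real.exp (-(1 / 2) * η ^ 2) * (j.factorial : ℝ)⁻¹ *
        hermiteProb j (η - d) * hermiteProb j (η + d) : ℝ) : ℂ) := by
  have hlin := linearization_of_recurrence (moment η d) ((η - d : ℝ) : ℂ) ((η + d : ℝ) : ℂ)
    (fun j => (hermiteProb j (η - d) : ℂ)) (fun j => (hermiteProb j (η + d) : ℂ))
    (by simp [hermiteProb_zero]) (by simp [hermiteProb_zero])
    (fun j => by rw [hermiteProb_succ]; push_cast; ring)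
    (fun j => by rw [hermiteProb_succ]; push_cast; ring)
    (moment_succ_left η d) (moment_succ_right η d) j j
  have h00 : moment η d 0 0 = ((√(2 * Real.pi) * Real.exp (-(1 / 2) * η ^ 2) : ℝ) : ℂ) := by
    simp only [moment, ← integral_gaussWave]; simp
  rw [h00] at hlin
  have hint : ∫ u : ℝ, gaussWave η u * ((lag 0 j (u ^ 2 + d ^ 2) : ℝ) : ℂ) =
      ∑ i ∈ Finset.range (j + 1), (j.choose i : ℂ) / (i.factorial : ℂ) * moment η d i i := by
    have (u : ℝ) : gaussWave η u * ((lag 0 j (u ^ 2 + d ^ 2) : ℝ) : ℂ) =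
        ∑ i ∈ Finset.range (j + 1), (-1) ^ i * (j.choose i : ℂ) / (i.factorial : ℂ) *
          (gaussWave η u * ((Polynomial.X + Polynomial.C (I * d)) ^ i *
            (Polynomial.X - Polynomial.C (I * d)) ^ i).eval (u : ℂ)) := by
      simp only [lag]
      push_cast
      rw [Finset.mul_sum]
      refine Finset.sum_congr rfl fun i _ => ?_
      rw [← mul_pow]
      simp only [Polynomial.eval_pow, Polynomial.eval_mul, Polynomial.eval_add,
        Polynomial.eval_sub, Polynomial.eval_X, Polynomial.eval_C]
      rw [show ((u : ℂ) + I * d) * (u - I * d) = (u : ℂ) ^ 2 + (d : ℂ) ^ 2 by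
        linear_combination (-(d : ℂ) ^ 2) * I_sq]
      simp only [zero_add, add_zero]
      ring
    simp only [this]
    rw [integral_finsetSum _ fun i _ => (integrable_gaussWave_mul_eval _ _).const_mul _]
    refine Finset.sum_congr rfl fun i _ => ?_
    rw [integral_const_mul, moment, ← two_mul, pow_mul, I_sq]
    ring
  -- Reversing the summation turns the moments of order `i` into those of order `j - i`, as in the
  -- linearization formula.
  rw [hint, ← Finset.sum_range_reflect]
  have hj : (j.factorial : ℂ) ≠ 0 := by exact_mod_cast j.factorial_ne_zero
  have : ∑ i ∈ Finset.range (j + 1), ((j.choose (j + 1 - 1 - i) : ℂ) /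
      ((j + 1 - 1 - i).factorial : ℂ) * moment η d (j + 1 - 1 - i) (j + 1 - 1 - i)) =
      (j.factorial : ℂ)⁻¹ * ∑ i ∈ Finset.range (j + 1),
        ((i.factorial * j.choose i * j.choose i : ℕ) : ℂ) * moment η d (j - i) (j - i) := by
    rw [Finset.mul_sum]
    refine Finset.sum_congr rfl fun i hi => ?_
    simp only [Finset.mem_range] at hi
    rw [Nat.add_sub_cancel, Nat.choose_symm (by omega)]
    have h1 : (j.choose i : ℂ) * i.factorial * (j - i).factorial = j.factorial := by
      exact_mod_cast Nat.choose_mul_factorial_mul_factorial (by omega)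
    have h2 : ((j - i).factorial : ℂ) ≠ 0 := by exact_mod_cast (j - i).factorial_ne_zero
    push_cast
    field_simp
    linear_combination (-(j.choose i : ℂ) * moment η d (j - i) (j - i)) * h1
  rw [this, hlin]
  push_cast
  ring

theorem sqrt_pi_mul_hermiteFun_mul_hermiteFun (j : ℕ) (η d : ℝ) :
    √Real.pi * hermiteFun j ((η - d) / √2) * hermiteFun j ((η + d) / √2) =
      (j.factorial : ℝ)⁻¹ * Real.exp (-(1 / 2) * η ^ 2) * Real.exp (-(1 / 2) * d ^ 2) *
        hermiteProb j (η - d) * hermiteProb j (η + d) := by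
  have hpi : 0 < √Real.pi := Real.sqrt_pos.mpr Real.pi_pos
  have hC : (0 : ℝ) < (2 : ℝ) ^ j * (j.factorial : ℝ) * √Real.pi := by positivity
  have hc : ((2 : ℝ) ^ j * (j.factorial : ℝ) * √Real.pi) ^ (-(1 / 2 : ℝ)) *
      ((2 : ℝ) ^ j * (j.factorial : ℝ) * √Real.pi) ^ (-(1 / 2 : ℝ)) =
      ((2 : ℝ) ^ j * (j.factorial : ℝ) * √Real.pi)⁻¹ := by
    rw [← Real.rpow_add hC, ← Real.rpow_neg_one]; norm_num
  have he : Real.exp (-(1 / 2) * ((η - d) / √2) ^ 2) * Real.exp (-(1 / 2) * ((η + d) / √2) ^ 2) =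
      Real.exp (-(1 / 2) * η ^ 2) * Real.exp (-(1 / 2) * d ^ 2) := by
    rw [← Real.exp_add, ← Real.exp_add]
    congr 1
    rw [div_pow, div_pow, Real.sq_sqrt (by norm_num)]
    ring
  have h2 : (√2)⁻¹ ^ j * (√2)⁻¹ ^ j = ((2 : ℝ) ^ j)⁻¹ := by
    rw [← mul_pow, ← mul_inv, Real.mul_self_sqrt (by norm_num), inv_pow]
  simp only [hermiteFun, hermiteProb]
  calc _ = √Real.pi * (((2 : ℝ) ^ j * (j.factorial : ℝ) * √Real.pi) ^ (-(1 / 2 : ℝ)) *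
      ((2 : ℝ) ^ j * (j.factorial : ℝ) * √Real.pi) ^ (-(1 / 2 : ℝ))) *
      (Real.exp (-(1 / 2) * ((η - d) / √2) ^ 2) * Real.exp (-(1 / 2) * ((η + d) / √2) ^ 2)) *
      ((physHermite j).eval ((η - d) / √2) * (physHermite j).eval ((η + d) / √2)) := by ring
    _ = (j.factorial : ℝ)⁻¹ * (Real.exp (-(1 / 2) * η ^ 2) * Real.exp (-(1 / 2) * d ^ 2)) *
      ((√2)⁻¹ ^ j * (√2)⁻¹ ^ j) *
      ((physHermite j).eval ((η - d) / √2) * (physHermite j).eval ((η + d) / √2)) := by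
        rw [hc, he, h2]; field_simp
    _ = _ := by ring

/-! ### Wirtinger calculus and polyanalytic functions. -/

variable {n : ℕ}

theorem contDiff_dbar (r : Fin n) {f : (Fin n → ℂ) → ℂ} (hf : ContDiff ℝ ∞ f) :
    ContDiff ℝ ∞ (dbar r f) := by
  have h : ContDiff ℝ ∞ (fderiv ℝ f) := hf.fderiv_right (by simp)
  unfold dbar
  exact contDiff_const.mul ((h.clm_apply contDiff_const).add
    (contDiff_const.mul (h.clm_apply contDiff_const)))

theorem dbar_comm (r s : Fin n) {f : (Fin n → ℂ) → ℂ} (hf : ContDiff ℝ ∞ f) :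
    dbar r (dbar s f) = dbar s (dbar r f) := by
  have h : ContDiff ℝ ∞ (fderiv ℝ f) := hf.fderiv_right (by simp)
  have hd : Differentiable ℝ (fderiv ℝ f) := h.differentiable (by simp)
  have key (s : Fin n) (z : Fin n → ℂ) (v : Fin n → ℂ) : fderiv ℝ (dbar s f) z v = (1 / 2 : ℂ) *
      (fderiv ℝ (fderiv ℝ f) z v (Pi.single s 1) +
        I * fderiv ℝ (fderiv ℝ f) z v (Pi.single s I)) := by
    have h1 (w : Fin n → ℂ) : HasFDerivAt (fun z => fderiv ℝ f z w)
        ((fderiv ℝ (fderiv ℝ f) z).flip w) z := by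
      have := (hd z).hasFDerivAt.clm_apply (hasFDerivAt_const w z)
      simpa using this
    have h2 := ((h1 (Pi.single s 1)).add ((h1 (Pi.single s I)).const_mul I)).const_mul (1 / 2 : ℂ)
    have h3 : HasFDerivAt (dbar s f) _ z := h2
    rw [h3.fderiv]
    simp
    ring
  have hsymm (z v w : Fin n → ℂ) :
      fderiv ℝ (fderiv ℝ f) z v w = fderiv ℝ (fderiv ℝ f) z w v :=
    (hf.contDiffAt.isSymmSndFDerivAt (by simpa using WithTop.coe_le_coe.2 (le_top : (2 : ℕ∞) ≤ ⊤))) v w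
  ext z
  rw [dbar, dbar, key s, key s, key r, key r, hsymm z (Pi.single r 1) (Pi.single s 1),
    hsymm z (Pi.single r I) (Pi.single s 1), hsymm z (Pi.single r 1) (Pi.single s I),
    hsymm z (Pi.single r I) (Pi.single s I)]
  ring

/-- The smooth functions that are annihilated by all words of length `j` in the operators
`∂/∂z̄_r`. -/
def DbarNil : ℕ → ((Fin n → ℂ) → ℂ) → Prop
  | 0, f => f = 0
  | j + 1, f => ContDiff ℝ ∞ f ∧ ∀ r, DbarNil j (dbar r f)

theorem DbarNil.contDiff {j : ℕ} {f : (Fin n → ℂ) → ℂ} (h : DbarNil j f) : ContDiff ℝ ∞ f := by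
  cases j with
  | zero => rw [DbarNil] at h; rw [h]; exact contDiff_const
  | succ j => exact h.1

theorem dbar_const (r : Fin n) (c : ℂ) : dbar r (fun _ => c) = 0 := by
  ext z; simp [dbar]

theorem dbarNil_zero (j : ℕ) : DbarNil j (0 : (Fin n → ℂ) → ℂ) := by
  induction j with
  | zero => rfl
  | succ j ih =>
    refine ⟨contDiff_const, fun r => ?_⟩
    have : dbar r (0 : (Fin n → ℂ) → ℂ) = 0 := dbar_const r 0
    rw [this]; exact ih

theorem DbarNil.succ {j : ℕ} {f : (Fin n → ℂ) → ℂ} (h : DbarNil j f) : DbarNil (j + 1) f := by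
  induction j generalizing f with
  | zero => rw [DbarNil] at h; rw [h]; exact dbarNil_zero 1
  | succ j ih => exact ⟨h.1, fun r => ih (h.2 r)⟩

theorem DbarNil.mono {i j : ℕ} (hij : i ≤ j) {f : (Fin n → ℂ) → ℂ} (h : DbarNil i f) :
    DbarNil j f := by
  induction hij with
  | refl => exact h
  | step _ ih => exact ih.succ

theorem dbar_add (r : Fin n) {f g : (Fin n → ℂ) → ℂ} (hf : Differentiable ℝ f)
    (hg : Differentiable ℝ g) : dbar r (f + g) = dbar r f + dbar r g := by
  ext z
  simp only [dbar, Pi.add_apply, fderiv_add (hf z) (hg z), _root_.add_apply]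
  ring

theorem dbar_mul (r : Fin n) {f g : (Fin n → ℂ) → ℂ} (hf : Differentiable ℝ f)
    (hg : Differentiable ℝ g) : dbar r (f * g) = dbar r f * g + f * dbar r g := by
  ext z
  simp only [dbar, Pi.add_apply, Pi.mul_apply, fderiv_mul (hf z) (hg z),
    _root_.add_apply, _root_.smul_apply, smul_eq_mul]
  ring

theorem dbar_of_differentiable (r : Fin n) {h : (Fin n → ℂ) → ℂ} (hh : Differentiable ℂ h) :
    dbar r h = 0 := by
  ext z
  have h1 : fderiv ℝ h z = (fderiv ℂ h z).restrictScalars ℝ :=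
    ((hh z).hasFDerivAt.restrictScalars ℝ).fderiv
  have h2 : (Pi.single r I : Fin n → ℂ) = I • Pi.single r (1 : ℂ) := by
    rw [← Pi.single_smul]; simp
  simp only [dbar, h1, ContinuousLinearMap.coe_restrictScalars', h2, map_smul, smul_eq_mul,
    Pi.zero_apply]
  linear_combination (1 / 2 * fderiv ℂ h z (Pi.single r 1)) * I_sq

theorem DbarNil.add {j : ℕ} {f g : (Fin n → ℂ) → ℂ} (hf : DbarNil j f) (hg : DbarNil j g) :
    DbarNil j (f + g) := by
  induction j generalizing f g with
  | zero => rw [DbarNil] at *; simp [hf, hg]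
  | succ j ih =>
    refine ⟨hf.1.add hg.1, fun r => ?_⟩
    rw [dbar_add r (hf.1.differentiable (by simp)) (hg.1.differentiable (by simp))]
    exact ih (hf.2 r) (hg.2 r)

theorem DbarNil.holo_mul {j : ℕ} {f h : (Fin n → ℂ) → ℂ} (hh : Differentiable ℂ h)
    (hh' : ContDiff ℝ ∞ h) (hf : DbarNil j f) : DbarNil j (h * f) := by
  induction j generalizing f with
  | zero => rw [DbarNil] at *; simp [hf]
  | succ j ih =>
    refine ⟨hh'.mul hf.1, fun r => ?_⟩
    rw [dbar_mul r (hh'.differentiable (by simp)) (hf.1.differentiable (by simp)),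
      dbar_of_differentiable r hh, zero_mul, zero_add]
    exact ih (hf.2 r)

theorem DbarNil.const_mul {j : ℕ} {f : (Fin n → ℂ) → ℂ} (c : ℂ) (hf : DbarNil j f) :
    DbarNil j (fun z => c * f z) :=
  DbarNil.holo_mul (h := fun _ => c) (differentiable_const c) contDiff_const hf

theorem DbarNil.sum {ι : Type*} {j : ℕ} (S : Finset ι) {f : ι → (Fin n → ℂ) → ℂ}
    (hf : ∀ i ∈ S, DbarNil j (f i)) : DbarNil j (∑ i ∈ S, f i) := by
  classical
  induction S using Finset.induction_on with
  | empty => exact dbarNil_zero j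
  | insert i S hi ih =>
    rw [Finset.sum_insert hi]
    exact (hf i (by simp)).add (ih fun k hk => hf k (by simp [hk]))

theorem dbarNil_one_of_differentiable {h : (Fin n → ℂ) → ℂ} (hh : Differentiable ℂ h)
    (hh' : ContDiff ℝ ∞ h) : DbarNil 1 h :=
  ⟨hh', fun r => dbar_of_differentiable r hh⟩

theorem dbar_comp_affine (r : Fin n) {f : (Fin n → ℂ) → ℂ} (hf : Differentiable ℝ f) (c : ℝ)
    (a : Fin n → ℂ) :
    dbar r (fun z => f (c • z + a)) = fun z => (c : ℂ) * dbar r f (c • z + a) := by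
  ext z
  have h1 : HasFDerivAt (fun z : Fin n → ℂ => c • z + a)
      (c • ContinuousLinearMap.id ℝ (Fin n → ℂ)) z :=
    ((hasFDerivAt_id z).const_smul c).add_const a
  have h2 : HasFDerivAt (fun z => f (c • z + a)) _ z := (hf (c • z + a)).hasFDerivAt.comp z h1
  simp only [dbar, h2.fderiv, ContinuousLinearMap.comp_apply, _root_.smul_apply,
    ContinuousLinearMap.id_apply, map_smul, real_smul]
  ring

theorem DbarNil.comp_affine {j : ℕ} {f : (Fin n → ℂ) → ℂ} (hf : DbarNil j f) (c : ℝ)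
    (a : Fin n → ℂ) : DbarNil j (fun z => f (c • z + a)) := by
  induction j generalizing f with
  | zero => rw [DbarNil] at *; simp [hf]; rfl
  | succ j ih =>
    refine ⟨hf.1.comp ((contDiff_const_smul c).add contDiff_const), fun r => ?_⟩
    rw [dbar_comp_affine r (hf.1.differentiable (by simp))]
    exact (ih (hf.2 r)).const_mul _

theorem contDiff_conj_coord (s : Fin n) (a : ℂ) :
    ContDiff ℝ ∞ (fun z : Fin n → ℂ => conj (z s - a)) :=
  conjCLE.contDiff.comp ((contDiff_apply ℝ ℂ s).sub contDiff_const)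

theorem dbar_conj_coord (r s : Fin n) (a : ℂ) :
    dbar r (fun z : Fin n → ℂ => conj (z s - a)) = fun _ => if s = r then 1 else 0 := by
  ext z
  have h1 : HasFDerivAt (fun z : Fin n → ℂ => conj (z s - a))
      ((conjCLE : ℂ →L[ℝ] ℂ).comp (ContinuousLinearMap.proj (R := ℝ) (φ := fun _ : Fin n => ℂ) s))
      z :=
    (conjCLE : ℂ →L[ℝ] ℂ).hasFDerivAt.comp z
      (((ContinuousLinearMap.proj (R := ℝ) (φ := fun _ : Fin n => ℂ) s).hasFDerivAt).sub_const a)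
  rw [dbar, h1.fderiv]
  by_cases h : s = r
  · subst h; simp; norm_num
  · simp [h]

/-- By Leibniz, each derivative either removes the conjugate coordinate or acts on `f`, so one such
factor costs exactly one extra order. -/
theorem DbarNil.conj_mul {j : ℕ} {f : (Fin n → ℂ) → ℂ} (hf : DbarNil j f) (s : Fin n) (a : ℂ) :
    DbarNil (j + 1) ((fun z : Fin n → ℂ => conj (z s - a)) * f) := by
  induction j generalizing f with
  | zero =>
    rw [DbarNil] at hf; rw [hf, mul_zero]; exact dbarNil_zero 1
  | succ j ih =>
    refine ⟨(contDiff_conj_coord s a).mul hf.1, fun r => ?_⟩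
    rw [dbar_mul r ((contDiff_conj_coord s a).differentiable (by simp))
      (hf.1.differentiable (by simp)), dbar_conj_coord]
    exact (hf.const_mul _).add (ih (hf.2 r))

theorem contDiff_iterate_dbar (r : Fin n) (i : ℕ) {f : (Fin n → ℂ) → ℂ} (hf : ContDiff ℝ ∞ f) :
    ContDiff ℝ ∞ ((dbar r)^[i] f) := by
  induction i with
  | zero => exact hf
  | succ i ih => rw [Function.iterate_succ_apply']; exact contDiff_dbar r ih

theorem iterate_dbar_comm (r s : Fin n) (i : ℕ) {f : (Fin n → ℂ) → ℂ} (hf : ContDiff ℝ ∞ f) :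
    (dbar r)^[i] (dbar s f) = dbar s ((dbar r)^[i] f) := by
  induction i with
  | zero => rfl
  | succ i ih =>
    rw [Function.iterate_succ_apply', ih, Function.iterate_succ_apply',
      dbar_comm r s (contDiff_iterate_dbar r i hf)]

theorem contDiff_foldr_dbar (l : List (Fin n)) (k : Fin n → ℕ) {f : (Fin n → ℂ) → ℂ}
    (hf : ContDiff ℝ ∞ f) :
    ContDiff ℝ ∞ (l.foldr (fun r g => (dbar r)^[k r] g) f) := by
  induction l with
  | nil => exact hf
  | cons r l ih => exact contDiff_iterate_dbar r _ ih

theorem foldr_dbar_dbar (l : List (Fin n)) (k : Fin n → ℕ) (s : Fin n) {f : (Fin n → ℂ) → ℂ}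
    (hf : ContDiff ℝ ∞ f) :
    l.foldr (fun r g => (dbar r)^[k r] g) (dbar s f) =
      dbar s (l.foldr (fun r g => (dbar r)^[k r] g) f) := by
  induction l with
  | nil => rfl
  | cons r l ih =>
    simp only [List.foldr_cons]
    rw [ih, iterate_dbar_comm r s _ (contDiff_foldr_dbar l k hf)]

theorem dbarPow_dbar (k : Fin n → ℕ) (s : Fin n) {f : (Fin n → ℂ) → ℂ} (hf : ContDiff ℝ ∞ f) :
    dbarPow k (dbar s f) = dbarPow (k + Pi.single s 1) f := by
  -- Induction over sublists: in a list without repetition the exponent at `s` is raised at most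
  -- once.
  have key (l : List (Fin n)) (hl : l.Nodup) :
      l.foldr (fun r g => (dbar r)^[(k + Pi.single s 1 : Fin n → ℕ) r] g) f =
        if s ∈ l then dbar s (l.foldr (fun r g => (dbar r)^[k r] g) f)
        else l.foldr (fun r g => (dbar r)^[k r] g) f := by
    induction l with
    | nil => simp
    | cons r l ih =>
      rw [List.nodup_cons] at hl
      simp only [List.foldr_cons]
      rw [ih hl.2]
      by_cases hr : s = r
      · subst hr
        simp only [hl.1, if_false, List.mem_cons, true_or, if_true, Pi.add_apply, Pi.single_eq_same]
        rw [Function.iterate_succ_apply']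
      · simp only [Pi.add_apply, Pi.single_eq_of_ne (Ne.symm hr), add_zero, List.mem_cons, hr,
          false_or]
        split_ifs
        · exact iterate_dbar_comm r s _ (contDiff_foldr_dbar l k hf)
        · rfl
  rw [dbarPow, dbarPow, key _ (List.nodup_finRange n), if_pos (List.mem_finRange s),
    foldr_dbar_dbar _ k s hf]

theorem DbarNil.iterate_dbar (r : Fin n) {i j : ℕ} {f : (Fin n → ℂ) → ℂ}
    (hf : DbarNil (i + j) f) : DbarNil j ((dbar r)^[i] f) := by
  induction i generalizing f with
  | zero => simpa using hf
  | succ i ih =>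
    rw [Function.iterate_succ_apply]
    rw [show i + 1 + j = i + j + 1 by omega] at hf
    exact ih (hf.2 r)

theorem DbarNil.foldr_dbar (l : List (Fin n)) (k : Fin n → ℕ) {j : ℕ} {f : (Fin n → ℂ) → ℂ}
    (hf : DbarNil ((l.map k).sum + j) f) :
    DbarNil j (l.foldr (fun r g => (dbar r)^[k r] g) f) := by
  induction l generalizing j with
  | nil => simpa using hf
  | cons r l ih =>
    simp only [List.foldr_cons]
    apply DbarNil.iterate_dbar
    apply ih
    simpa [add_comm, add_left_comm, add_assoc] using hf

/-- The operators commute on smooth functions, so annihilation by words and by multi-index powers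
coincide. The recursive form strips one derivative at a time, which suits induction. -/
theorem isPolyanalytic_iff_dbarNil {m : ℕ} {f : (Fin n → ℂ) → ℂ} :
    IsPolyanalytic m f ↔ DbarNil m f := by
  constructor
  · intro h
    induction m generalizing f with
    | zero =>
      have := h.2 0 (by simp)
      have h0 : dbarPow 0 f = f := by
        have (l : List (Fin n)) :
            l.foldr (fun r g => (dbar r)^[(0 : Fin n → ℕ) r] g) f = f := by
          induction l with
          | nil => rfl
          | cons r l ih => simp
        exact this _
      rw [h0] at this
      exact funext this
    | succ m ih =>
      refine ⟨h.1, fun r => ih ⟨contDiff_dbar r h.1, fun k hk z => ?_⟩⟩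
      rw [dbarPow_dbar k r h.1]
      exact h.2 _ (by simp [Finset.sum_add_distrib, hk]) z
  · intro h
    refine ⟨h.contDiff, fun k hk z => ?_⟩
    have hs : ((List.finRange n).map k).sum = m := by
      rw [← hk, ← List.ofFn_eq_map, List.sum_ofFn]
    have : DbarNil 0 (dbarPow k f) := DbarNil.foldr_dbar _ k (by rw [hs]; exact h)
    rw [DbarNil] at this
    rw [this]; rfl

/-! ### Restriction to complex lines and circle means. -/

theorem fderiv_apply_eq_sum (G : (Fin n → ℂ) → ℂ) (z v : Fin n → ℂ) :
    fderiv ℝ G z v = ∑ r, ((v r).re * fderiv ℝ G z (Pi.single r 1) +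
      (v r).im * fderiv ℝ G z (Pi.single r I)) := by
  have hv : v = ∑ r, ((v r).re • (Pi.single r 1 : Fin n → ℂ) +
      (v r).im • (Pi.single r I : Fin n → ℂ)) := by
    ext s
    simp only [Finset.sum_apply, Pi.add_apply, Pi.smul_apply, Pi.single_apply, smul_ite, smul_zero]
    rw [Finset.sum_add_distrib]
    simp [re_add_im]
  conv_lhs => rw [hv]
  simp

theorem wirtinger_comp_ray (G : (Fin n → ℂ) → ℂ) (z w : Fin n → ℂ) :
    fderiv ℝ G z w + I * fderiv ℝ G z (I • w) = 2 * ∑ r, conj (w r) * dbar r G z := by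
  rw [fderiv_apply_eq_sum G z w, fderiv_apply_eq_sum G z (I • w), Finset.mul_sum, Finset.mul_sum,
    ← Finset.sum_add_distrib]
  refine Finset.sum_congr rfl fun r _ => ?_
  have hc : conj (w r) = (w r).re - (w r).im * I := by
    apply Complex.ext <;> simp
  rw [hc]
  simp only [dbar, Pi.smul_apply, smul_eq_mul, mul_re, mul_im, I_re, I_im]
  push_cast
  linear_combination ((w r).im * fderiv ℝ G z (Pi.single r I)) * I_sq

theorem wirtinger_conj_pow_mul (k : ℕ) {h : ℂ → ℂ} (hh : Differentiable ℂ h) (x : ℂ) :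
    DifferentiableAt ℝ (fun x : ℂ => conj x ^ (k + 1) * h x) x ∧
    fderiv ℝ (fun x : ℂ => conj x ^ (k + 1) * h x) x 1 +
      I * fderiv ℝ (fun x : ℂ => conj x ^ (k + 1) * h x) x I =
      2 * (k + 1) * (conj x ^ k * h x) := by
  have h1 : HasFDerivAt (fun x : ℂ => conj x) (conjCLE : ℂ →L[ℝ] ℂ) x :=
    (conjCLE : ℂ →L[ℝ] ℂ).hasFDerivAt
  have h2 : HasFDerivAt h ((fderiv ℂ h x).restrictScalars ℝ) x :=
    (hh x).hasFDerivAt.restrictScalars ℝ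
  have h3 := (h1.pow (k + 1)).mul h2
  have h4 : HasFDerivAt (fun x : ℂ => conj x ^ (k + 1) * h x) _ x := h3
  refine ⟨h4.differentiableAt, ?_⟩
  rw [h4.fderiv]
  simp
  linear_combination (conj x ^ (k + 1) * deriv h x - (k + 1) * conj x ^ k * h x) * I_sq

/-- The conjugate derivative of `x ↦ G (x • w)` is a combination of the `dbar r G`, known by
induction. Integrating it formally in the conjugate variable leaves an error that is entire. -/
theorem DbarNil.exists_ray_decomposition {j : ℕ} {G : (Fin n → ℂ) → ℂ} (hG : DbarNil j G)
    (w : Fin n → ℂ) : ∃ h : ℕ → ℂ → ℂ, (∀ k, Differentiable ℂ (h k)) ∧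
      ∀ x : ℂ, G (x • w) = ∑ k ∈ Finset.range j, conj x ^ k * h k x := by
  induction j generalizing G with
  | zero =>
    rw [DbarNil] at hG
    exact ⟨fun _ _ => 0, fun _ => differentiable_const _, fun x => by simp [hG]⟩
  | succ j ih =>
    choose h hh hs using fun r => ih (hG.2 r)
    set H : ℕ → ℂ → ℂ := fun k x => ∑ r, conj (w r) * h r k x with hHdef
    have hH (k : ℕ) : Differentiable ℂ (H k) :=
      Differentiable.fun_sum fun r _ => (hh r k).const_mul _
    have hGd : Differentiable ℝ G := hG.1.differentiable (by simp)
    have hray (x : ℂ) : HasFDerivAt (fun x : ℂ => G (x • w))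
        ((fderiv ℝ G (x • w)).comp
          (ContinuousLinearMap.smulRight (ContinuousLinearMap.id ℝ ℂ) w)) x := by
      have h1 : HasFDerivAt (fun x : ℂ => x • w)
          (ContinuousLinearMap.smulRight (ContinuousLinearMap.id ℝ ℂ) w) x :=
        (ContinuousLinearMap.smulRight (ContinuousLinearMap.id ℝ ℂ) w).hasFDerivAt
      exact (hGd (x • w)).hasFDerivAt.comp x h1
    -- The subtracted sum is the formal antiderivative in `conj x`, so `ψ` satisfies the
    -- Cauchy–Riemann equations; it becomes the coefficient of index `0`.
    set ψ : ℂ → ℂ := fun x => G (x • w) -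
      ∑ k ∈ Finset.range j, ((k : ℂ) + 1)⁻¹ * (conj x ^ (k + 1) * H k x) with hψ
    have hψd : Differentiable ℂ ψ := by
      intro x
      have hF (k : ℕ) := wirtinger_conj_pow_mul k (hH k) x
      have hD : HasFDerivAt ψ _ x := (hray x).sub (HasFDerivAt.fun_sum (u := Finset.range j)
        fun k _ => ((hF k).1.hasFDerivAt.const_mul ((k : ℂ) + 1)⁻¹))
      rw [differentiableAt_complex_iff_differentiableAt_real]
      refine ⟨hD.differentiableAt, ?_⟩
      have hz : fderiv ℝ ψ x 1 + I * fderiv ℝ ψ x I = 0 := by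
        rw [hD.fderiv]
        have hw := wirtinger_comp_ray G (x • w) w
        simp only [_root_.sub_apply, ContinuousLinearMap.comp_apply,
          ContinuousLinearMap.smulRight_apply, ContinuousLinearMap.id_apply, one_smul,
          _root_.sum_apply, _root_.smul_apply, smul_eq_mul]
        have e1 : (∑ k ∈ Finset.range j, ((k : ℂ) + 1)⁻¹ *
              fderiv ℝ (fun x : ℂ => conj x ^ (k + 1) * H k x) x 1) +
            I * ∑ k ∈ Finset.range j, ((k : ℂ) + 1)⁻¹ *
              fderiv ℝ (fun x : ℂ => conj x ^ (k + 1) * H k x) x I =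
            ∑ k ∈ Finset.range j, 2 * (conj x ^ k * H k x) := by
          rw [Finset.mul_sum, ← Finset.sum_add_distrib]
          refine Finset.sum_congr rfl fun k _ => ?_
          have hk : (k : ℂ) + 1 ≠ 0 := by exact_mod_cast k.succ_ne_zero
          rw [mul_left_comm, ← mul_add, (hF k).2]
          field_simp
        have e2 : ∑ r, conj (w r) * dbar r G (x • w) =
            ∑ k ∈ Finset.range j, conj x ^ k * H k x := by
          simp only [hs, hHdef, Finset.mul_sum]
          rw [Finset.sum_comm]
          refine Finset.sum_congr rfl fun k _ => Finset.sum_congr rfl fun r _ => ?_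
          ring
        rw [e2, Finset.mul_sum] at hw
        linear_combination hw - e1
      rw [smul_eq_mul]
      linear_combination (-I) * hz + fderiv ℝ ψ x I * I_sq
    refine ⟨fun k => if k = 0 then ψ else fun x => ((k : ℂ))⁻¹ * H (k - 1) x, fun k => ?_,
      fun x => ?_⟩
    · dsimp only
      split_ifs
      · exact hψd
      · exact (hH _).const_mul _
    · rw [Finset.sum_range_succ']
      simp only [hψ, Nat.succ_ne_zero, if_false, if_true, pow_zero, one_mul, Nat.add_sub_cancel]
      push_cast
      rw [← sub_eq_iff_eq_add']
      refine congrArg _ (Finset.sum_congr rfl fun k _ => ?_)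
      ring

/-- On the circle the conjugate of `z` is `ρ² / z`, which makes this Cauchy's formula for the `k`-th
Taylor coefficient. -/
theorem integral_circleMap_conj_pow_mul (k : ℕ) {h : ℂ → ℂ} (hh : Differentiable ℂ h) {ρ : ℝ}
    (hρ : 0 < ρ) :
    ∫ θ in (0 : ℝ)..2 * Real.pi, conj (circleMap 0 ρ θ) ^ k * h (circleMap 0 ρ θ) =
      2 * Real.pi * ((k.factorial : ℂ)⁻¹ * iteratedDeriv k h 0) * (ρ : ℂ) ^ (2 * k) := by
  have h1 := (hh.differentiableOn (s := Metric.closedBall 0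
    ρ)).circleIntegral_one_div_sub_center_pow_smul hρ k
  simp only [circleIntegral, deriv_circleMap, sub_zero, smul_eq_mul] at h1
  -- The factor `-I` cancels the `I` of `dz = iz dθ`, and `ρ^{2k}` converts `z^{-k}` into the
  -- conjugate power.
  have h2 (θ : ℝ) : circleMap 0 ρ θ * I * (1 / circleMap 0 ρ θ ^ (k + 1) * h (circleMap 0 ρ θ)) *
      (-I * (ρ : ℂ) ^ (2 * k)) = conj (circleMap 0 ρ θ) ^ k * h (circleMap 0 ρ θ) := by
    have hne : circleMap 0 ρ θ ≠ 0 := circleMap_ne_center hρ.ne'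
    have hc : conj (circleMap 0 ρ θ) = (ρ : ℂ) ^ 2 * (circleMap 0 ρ θ)⁻¹ := by
      rw [eq_mul_inv_iff_mul_eq₀ hne, ← Complex.normSq_eq_conj_mul_self, Complex.normSq_eq_norm_sq,
        norm_circleMap_zero]
      push_cast
      rw [← Complex.ofReal_pow, sq_abs, Complex.ofReal_pow]
    rw [hc, mul_pow, ← pow_mul, pow_succ, inv_pow]
    field_simp
    linear_combination (-h (circleMap 0 ρ θ) * (ρ : ℂ) ^ (2 * k)) * I_sq
  simp only [← h2]
  rw [intervalIntegral.integral_mul_const, h1]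
  linear_combination (-(2 * Real.pi * ((k.factorial : ℂ)⁻¹ * iteratedDeriv k h 0) *
    (ρ : ℂ) ^ (2 * k))) * I_sq

theorem DbarNil.exists_circle_mean {j : ℕ} {G : (Fin n → ℂ) → ℂ} (hG : DbarNil (j + 1) G)
    (w : Fin n → ℂ) : ∃ c : ℕ → ℂ, c 0 = G 0 ∧ ∀ ρ : ℝ, 0 < ρ →
      ∫ θ in (0 : ℝ)..2 * Real.pi, G (circleMap 0 ρ θ • w) =
        2 * Real.pi * ∑ k ∈ Finset.range (j + 1), c k * (ρ : ℂ) ^ (2 * k) := by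
  obtain ⟨h, hh, hs⟩ := hG.exists_ray_decomposition w
  refine ⟨fun k => (k.factorial : ℂ)⁻¹ * iteratedDeriv k (h k) 0, ?_, fun ρ hρ => ?_⟩
  · have := hs 0
    rw [Finset.sum_range_succ'] at this
    simp at this
    simp [this]
  · simp only [hs]
    rw [intervalIntegral.integral_finsetSum, Finset.mul_sum]
    · refine Finset.sum_congr rfl fun k _ => ?_
      rw [integral_circleMap_conj_pow_mul k (hh k) hρ]
      ring
    · intro k _
      apply Continuous.intervalIntegrable
      have := (hh k).continuous
      fun_prop

/-! ### Gaussian integrals, polar coordinates and the weighted mean value formula. -/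

/-- The squared Euclidean norm on `ℂⁿ`. -/
def normSqSum (w : Fin n → ℂ) : ℝ := ∑ r, ‖w r‖ ^ 2

theorem normSqSum_nonneg (w : Fin n → ℂ) : 0 ≤ normSqSum w :=
  Finset.sum_nonneg fun _ _ => by positivity

theorem continuous_normSqSum : Continuous (normSqSum (n := n)) := by
  unfold normSqSum; fun_prop

theorem normSqSum_smul (c : ℂ) (w : Fin n → ℂ) : normSqSum (c • w) = ‖c‖ ^ 2 * normSqSum w := by
  simp [normSqSum, Finset.mul_sum, mul_pow]

theorem normSqSum_pos {w : Fin n → ℂ} (hw : w ≠ 0) : 0 < normSqSum w := by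
  obtain ⟨r, hr⟩ := Function.ne_iff.mp hw
  have h1 : 0 < ‖w r‖ ^ 2 := by
    have : 0 < ‖w r‖ := norm_pos_iff.mpr hr
    positivity
  exact h1.trans_le (Finset.single_le_sum (f := fun r => ‖w r‖ ^ 2) (fun _ _ => by positivity)
    (Finset.mem_univ r))

theorem continuous_lag (a M : ℕ) : Continuous (lag a M) := by
  unfold lag; fun_prop

theorem exp_neg_mul_normSqSum (b : ℝ) (w : Fin n → ℂ) :
    Real.exp (-b * normSqSum w) = ∏ r, Real.exp (-b * ‖w r‖ ^ 2) := by
  rw [normSqSum, Finset.mul_sum, Real.exp_sum]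

theorem integrable_exp_neg_mul_normSqSum {b : ℝ} (hb : 0 < b) :
    Integrable (fun w : Fin n → ℂ => Real.exp (-b * normSqSum w)) := by
  simp only [exp_neg_mul_normSqSum]
  refine Integrable.fintype_prod (f := fun _ (x : ℂ) => Real.exp (-b * ‖x‖ ^ 2)) fun _ => ?_
  have h : Integrable (fun x : ℂ => cexp (-(b : ℂ) * (‖x‖ : ℂ) ^ 2)) := by
    simpa using GaussianFourier.integrable_cexp_neg_mul_sq_norm_add (V := ℂ) (b := (b : ℂ))
      (by simpa using hb) 0 0
  refine h.norm.congr (Filter.Eventually.of_forall fun x => ?_)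
  simp only [Complex.norm_exp]
  congr 1
  rw [← Complex.ofReal_pow, ← Complex.ofReal_neg, ← Complex.ofReal_mul, Complex.ofReal_re]

theorem integral_exp_neg_normSqSum :
    ∫ w : Fin n → ℂ, Real.exp (-normSqSum w) = Real.pi ^ n := by
  have h (w : Fin n → ℂ) : Real.exp (-normSqSum w) = ∏ r, Real.exp (-1 * ‖w r‖ ^ 2) := by
    rw [← exp_neg_mul_normSqSum, neg_one_mul]
  simp only [h]
  rw [integral_fintype_prod_volume_eq_prod (f := fun _ (x : ℂ) => Real.exp (-1 * ‖x‖ ^ 2)),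
    GaussianFourier.integral_rexp_neg_mul_sq_norm one_pos]
  simp

/-- The rate `1/4` is small enough that the squared bound times `exp (-s)` still decays like `exp
(-s/2)`. -/
theorem exists_abs_lag_le (a M : ℕ) :
    ∃ C : ℝ, ∀ s, 0 ≤ s → |lag a M s| ≤ C * Real.exp (s / 4) := by
  refine ⟨∑ i ∈ Finset.range (M + 1), ((M + a).choose (a + i) : ℝ) * 4 ^ i, fun s hs => ?_⟩
  rw [lag, Finset.sum_mul]
  refine (Finset.abs_sum_le_sum_abs _ _).trans (Finset.sum_le_sum fun i _ => ?_)
  have h := Real.pow_div_factorial_le_exp (s / 4) (by positivity) i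
  have h2 : |(-1) ^ i * ((M + a).choose (a + i) : ℝ) / (i.factorial : ℝ) * s ^ i| =
      ((M + a).choose (a + i) : ℝ) * 4 ^ i * ((s / 4) ^ i / (i.factorial : ℝ)) := by
    rw [abs_mul, abs_div, abs_mul, abs_pow, abs_neg, abs_one, one_pow, one_mul, Nat.abs_cast,
      Nat.abs_cast, abs_of_nonneg (pow_nonneg hs i), div_pow]
    field_simp
  rw [h2]
  gcongr

theorem integrable_lag_sq_mul_exp (a M : ℕ) :
    Integrable (fun w : Fin n → ℂ => lag a M (normSqSum w) ^ 2 * Real.exp (-normSqSum w)) := by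
  obtain ⟨C, hC⟩ := exists_abs_lag_le a M
  refine ((integrable_exp_neg_mul_normSqSum (b := 1 / 2) (by norm_num)).const_mul (C ^ 2)).mono' ?_
    (Filter.Eventually.of_forall fun w => ?_)
  · have := continuous_lag a M
    have := continuous_normSqSum (n := n)
    exact Continuous.aestronglyMeasurable (by fun_prop)
  · have h := hC _ (normSqSum_nonneg w)
    rw [Real.norm_of_nonneg (by positivity), ← sq_abs]
    calc |lag a M (normSqSum w)| ^ 2 * Real.exp (-normSqSum w)
        ≤ (C * Real.exp (normSqSum w / 4)) ^ 2 * Real.exp (-normSqSum w) := by gcongr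
      _ = C ^ 2 * Real.exp (-(1 / 2) * normSqSum w) := by
        rw [mul_pow, mul_assoc, pow_two (Real.exp _), ← Real.exp_add, ← Real.exp_add]
        congr 2; ring

theorem integrableOn_pow_mul_exp {σ : ℝ} (hσ : 0 < σ) (p : ℕ) :
    IntegrableOn (fun r : ℝ => r ^ p * Real.exp (-σ * r ^ 2)) (Set.Ioi 0) := by
  have := integrableOn_rpow_mul_exp_neg_mul_sq hσ (s := p)
    (by have : (0 : ℝ) ≤ p := by positivity
        linarith)
  simpa using this

theorem integral_pow_mul_exp {σ : ℝ} (hσ : 0 < σ) (p : ℕ) :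
    ∫ r in Set.Ioi (0 : ℝ), r ^ (2 * p + 1) * Real.exp (-σ * r ^ 2) =
      (p.factorial : ℝ) / (2 * σ ^ (p + 1)) := by
  have h := _root_.integral_rpow_mul_exp_neg_mul_rpow (p := 2) (q := (2 * p + 1 : ℕ)) (b := σ)
    (by norm_num) (by have : (0 : ℝ) ≤ (2 * p + 1 : ℕ) := by positivity
                      linarith) hσ
  have e : (((2 * p + 1 : ℕ) : ℝ) + 1) / 2 = p + 1 := by push_cast; ring
  have e' : -(((2 * p + 1 : ℕ) : ℝ) + 1) / 2 = -((p + 1 : ℕ) : ℝ) := by push_cast; ring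
  rw [e, e', Real.Gamma_nat_eq_factorial, Real.rpow_neg hσ.le, Real.rpow_natCast] at h
  simp only [Real.rpow_natCast, Real.rpow_two] at h
  rw [h]
  field_simp

/-- In complex dimension `N + 1` the radial density is `r^{2N+1}`. Gaussian moments turn the
integral into the alternating binomial sum, so powers `r^{2a}` with `1 ≤ a ≤ M` are killed. -/
theorem integral_radial_mul_lag (N M : ℕ) {σ : ℝ} (hσ : 0 < σ) (a : ℕ) (ha : a ≤ M) :
    IntegrableOn (fun r : ℝ => r ^ (2 * N + 1) * (r ^ (2 * a) * (lag (N + 1) M (r ^ 2 * σ) *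
      Real.exp (-(r ^ 2 * σ))))) (Set.Ioi 0) ∧
    ∫ r in Set.Ioi (0 : ℝ), r ^ (2 * N + 1) * (r ^ (2 * a) * (lag (N + 1) M (r ^ 2 * σ) *
      Real.exp (-(r ^ 2 * σ)))) =
      if a = 0 then ∫ r in Set.Ioi (0 : ℝ), r ^ (2 * N + 1) * Real.exp (-(r ^ 2 * σ)) else 0 := by
  have he (r : ℝ) : Real.exp (-(r ^ 2 * σ)) = Real.exp (-σ * r ^ 2) := by congr 1; ring
  simp only [he]
  have hexp (r : ℝ) : r ^ (2 * N + 1) * (r ^ (2 * a) * (lag (N + 1) M (r ^ 2 * σ) *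
      Real.exp (-σ * r ^ 2))) = ∑ i ∈ Finset.range (M + 1),
      (-1) ^ i * ((M + (N + 1)).choose (N + 1 + i) : ℝ) / (i.factorial : ℝ) * σ ^ i *
        (r ^ (2 * (N + a + i) + 1) * Real.exp (-σ * r ^ 2)) := by
    rw [lag, Finset.sum_mul, Finset.mul_sum, Finset.mul_sum]
    refine Finset.sum_congr rfl fun i _ => ?_
    rw [mul_pow, ← pow_mul]
    ring
  simp only [hexp]
  refine ⟨integrable_finsetSum _ fun i _ => (integrableOn_pow_mul_exp hσ _).const_mul _, ?_⟩
  rw [integral_finsetSum _ fun i _ => (integrableOn_pow_mul_exp hσ _).const_mul _]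
  simp only [integral_const_mul, integral_pow_mul_exp hσ]
  have h1 := alternating_sum_choose_mul_choose (N + 1) M a (by omega) ha
  have h2 : ∀ i ∈ Finset.range (M + 1), (-1) ^ i * ((M + (N + 1)).choose (N + 1 + i) : ℝ) /
      (i.factorial : ℝ) * σ ^ i * (((N + a + i).factorial : ℝ) / (2 * σ ^ (N + a + i + 1))) =
      ((N + a).factorial : ℝ) / (2 * σ ^ (N + a + 1)) * ((-1 : ℝ) ^ i *
        ((M + (N + 1)).choose (N + 1 + i) : ℝ) *
        ((N + 1 + a - 1 + i).choose (N + 1 + a - 1) : ℝ)) := by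
    intro i _
    have h3 : ((N + 1 + a - 1 + i).choose (N + 1 + a - 1) : ℝ) * (N + a).factorial * i.factorial =
        (N + a + i).factorial := by
      rw [show N + 1 + a - 1 = N + a by omega]
      rw [Nat.choose_symm_add]
      exact_mod_cast Nat.add_choose_mul_factorial_mul_factorial (N + a) i
    rw [← h3]
    have : (i.factorial : ℝ) ≠ 0 := by positivity
    field_simp
    ring
  rw [Finset.sum_congr rfl h2, ← Finset.mul_sum, h1]
  split_ifs with h
  · subst h; simp
  · simp

theorem integral_radial_poly_mul_lag (N M : ℕ) {σ : ℝ} (hσ : 0 < σ) (c : ℕ → ℂ) :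
    ∫ r in Set.Ioi (0 : ℝ), r ^ (2 * N + 1) • ((∑ k ∈ Finset.range (M + 1),
      c k * (r : ℂ) ^ (2 * k)) * ((lag (N + 1) M (r ^ 2 * σ) *
        Real.exp (-(r ^ 2 * σ)) : ℝ) : ℂ)) =
      c 0 * ∫ r in Set.Ioi (0 : ℝ), r ^ (2 * N + 1) • ((Real.exp (-(r ^ 2 * σ)) : ℝ) : ℂ) := by
  have hexp (r : ℝ) : r ^ (2 * N + 1) • ((∑ k ∈ Finset.range (M + 1),
      c k * (r : ℂ) ^ (2 * k)) * ((lag (N + 1) M (r ^ 2 * σ) *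
        Real.exp (-(r ^ 2 * σ)) : ℝ) : ℂ)) = ∑ k ∈ Finset.range (M + 1), c k *
      ((r ^ (2 * N + 1) * (r ^ (2 * k) * (lag (N + 1) M (r ^ 2 * σ) *
      Real.exp (-(r ^ 2 * σ)))) : ℝ) : ℂ) := by
    rw [Finset.sum_mul, Finset.smul_sum]
    refine Finset.sum_congr rfl fun k _ => ?_
    rw [real_smul]
    push_cast; ring
  have hk (k : ℕ) (hk : k ∈ Finset.range (M + 1)) := integral_radial_mul_lag N M hσ k
    (Nat.lt_succ_iff.mp (Finset.mem_range.mp hk))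
  simp only [hexp]
  have hi : ∀ k ∈ Finset.range (M + 1), IntegrableOn (fun r : ℝ => c k *
      ((r ^ (2 * N + 1) * (r ^ (2 * k) * (lag (N + 1) M (r ^ 2 * σ) *
      Real.exp (-(r ^ 2 * σ)))) : ℝ) : ℂ)) (Set.Ioi 0) :=
    fun k h => ((hk k h).1.ofReal (𝕜 := ℂ)).const_mul _
  rw [integral_finsetSum _ hi]
  have h2 : ∀ k ∈ Finset.range (M + 1), ∫ r in Set.Ioi (0 : ℝ), c k *
      ((r ^ (2 * N + 1) * (r ^ (2 * k) * (lag (N + 1) M (r ^ 2 * σ) *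
      Real.exp (-(r ^ 2 * σ)))) : ℝ) : ℂ) = if k = 0 then
      c 0 * ∫ r in Set.Ioi (0 : ℝ), r ^ (2 * N + 1) • ((Real.exp (-(r ^ 2 * σ)) : ℝ) : ℂ)
      else 0 := by
    intro k h
    rw [integral_const_mul, integral_complex_ofReal, (hk k h).2]
    split_ifs with h0
    · subst h0
      rw [← integral_complex_ofReal]
      simp [real_smul]
    · simp
  rw [Finset.sum_congr rfl h2]
  simp

/-- The unit sphere here is that of the sup norm on `Fin n → ℂ`. Hence the Euclidean `normSqSum` is
not constant on it, which is why the radial lemmas carry a parameter `σ`. -/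
theorem integral_polar (hn : 1 ≤ n) {F : (Fin n → ℂ) → ℂ} (hF : Integrable F) :
    ∫ w, F w = ∫ x : Metric.sphere (0 : Fin n → ℂ) 1,
      (∫ r in Set.Ioi (0 : ℝ), r ^ (2 * n - 1) • F ((r : ℂ) • (x : Fin n → ℂ)))
        ∂(volume : Measure (Fin n → ℂ)).toSphere := by
  have hdim : Module.finrank ℝ (Fin n → ℂ) = 2 * n := by
    rw [Module.finrank_pi_fintype]; simp [mul_comm]
  have : Nonempty (Fin n) := ⟨⟨0, hn⟩⟩
  set μ : Measure (Fin n → ℂ) := volume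
  set g : Metric.sphere (0 : Fin n → ℂ) 1 × Set.Ioi (0 : ℝ) → ℂ :=
    fun p => F ((p.2 : ℝ) • (p.1 : Fin n → ℂ)) with hg
  have hgx (x : ({0}ᶜ : Set (Fin n → ℂ))) : g (homeomorphUnitSphereProd (Fin n → ℂ) x) = F x := by
    have := congrArg Subtype.val ((homeomorphUnitSphereProd (Fin n → ℂ)).symm_apply_apply x)
    rw [homeomorphUnitSphereProd_symm_apply_coe] at this
    simp only [hg, this]
  have hmp := μ.measurePreserving_homeomorphUnitSphereProd
  have hI : Integrable g (μ.toSphere.prod (.volumeIoiPow (Module.finrank ℝ (Fin n → ℂ) - 1))) := by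
    rw [← hmp.integrable_comp_emb (Homeomorph.measurableEmbedding _)]
    have h1 : g ∘ (homeomorphUnitSphereProd (Fin n → ℂ)) = F ∘ Subtype.val := funext hgx
    rw [h1, ← integrableOn_iff_comap_subtypeVal (measurableSet_singleton _).compl]
    exact hF.integrableOn
  calc ∫ w, F w = ∫ x : ({0}ᶜ : Set (Fin n → ℂ)), F x ∂(μ.comap (↑)) := by
        rw [integral_subtype_comap (measurableSet_singleton _).compl,
          restrict_compl_singleton]
    _ = ∫ p, g p ∂(μ.toSphere.prod (.volumeIoiPow (Module.finrank ℝ (Fin n → ℂ) - 1))) := by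
        rw [← hmp.integral_comp (Homeomorph.measurableEmbedding _)]
        simp only [hgx]
    _ = _ := by
        rw [integral_prod _ hI, hdim]
        refine integral_congr_ae (Filter.Eventually.of_forall fun x => ?_)
        simp only [Measure.volumeIoiPow, ENNReal.ofReal, hg]
        rw [integral_withDensity_eq_integral_smul,
          integral_subtype_comap measurableSet_Ioi fun a : ℝ ↦
            Real.toNNReal (a ^ (2 * n - 1)) • F (a • (x : Fin n → ℂ))]
        · refine setIntegral_congr_fun measurableSet_Ioi fun r hr => ?_
          simp only [NNReal.smul_def]
          rw [Real.coe_toNNReal _ (pow_nonneg (le_of_lt hr) _)]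
          congr 2
        · exact (measurable_subtype_coe.pow_const _).real_toNNReal

theorem measurePreserving_smul_circle (c : Circle) :
    MeasurePreserving (fun w : Fin n → ℂ => (c : ℂ) • w) :=
  volume_preserving_pi fun _ => (rotation c).measurePreserving

theorem integrable_mul_lag {M : ℕ} {G : (Fin n → ℂ) → ℂ} (hG : Continuous G)
    (hI : Integrable (fun w => ‖G w‖ ^ 2 * Real.exp (-normSqSum w))) (a : ℕ) :
    Integrable (fun w => G w * ((lag a M (normSqSum w) * Real.exp (-normSqSum w) : ℝ) : ℂ)) := by
  refine (hI.add (integrable_lag_sq_mul_exp a M)).mono' ?_ (Filter.Eventually.of_forall fun w => ?_)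
  · have := continuous_lag a M
    have := continuous_normSqSum (n := n)
    exact Continuous.aestronglyMeasurable (by fun_prop)
  · rw [norm_mul, Complex.norm_real, Real.norm_eq_abs, abs_mul, Real.abs_exp, Pi.add_apply,
      ← add_mul, ← mul_assoc, ← sq_abs (lag a M _)]
    have : ‖G w‖ * |lag a M (normSqSum w)| ≤ ‖G w‖ ^ 2 + |lag a M (normSqSum w)| ^ 2 := by
      nlinarith [sq_nonneg (‖G w‖ - |lag a M (normSqSum w)|), sq_nonneg ‖G w‖,
        sq_nonneg |lag a M (normSqSum w)|]
    gcongr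

/-- Multiplication by a phase preserves volume, so Fubini allows replacing `Φ` by its average along
each circle; no larger symmetry group is required. -/
theorem integral_circle_average {Φ : (Fin n → ℂ) → ℂ} (hc : Continuous Φ) (hI : Integrable Φ) :
    Integrable (fun w => ∫ θ in (0 : ℝ)..2 * Real.pi, Φ (circleMap 0 1 θ • w)) ∧
    ∫ w, ∫ θ in (0 : ℝ)..2 * Real.pi, Φ (circleMap 0 1 θ • w) = 2 * Real.pi * ∫ w, Φ w := by
  have hcm (θ : ℝ) : circleMap 0 1 θ = (Circle.exp θ : ℂ) := by simp [circleMap]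
  have hemb (θ : ℝ) : MeasurableEmbedding (fun w : Fin n → ℂ => circleMap 0 1 θ • w) :=
    (Homeomorph.smulOfNeZero (circleMap 0 1 θ)
      (circleMap_ne_center one_ne_zero)).measurableEmbedding
  have hmp (θ : ℝ) : MeasurePreserving (fun w : Fin n → ℂ => circleMap 0 1 θ • w) := by
    rw [hcm]; exact measurePreserving_smul_circle _
  have hjoint : Integrable (Function.uncurry fun (w : Fin n → ℂ) (θ : ℝ) =>
      Φ (circleMap 0 1 θ • w)) (volume.prod (volume.restrict (Set.Ioc 0 (2 * Real.pi)))) := by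
    have hm : AEStronglyMeasurable (Function.uncurry fun (w : Fin n → ℂ) (θ : ℝ) =>
        Φ (circleMap 0 1 θ • w)) (volume.prod (volume.restrict (Set.Ioc 0 (2 * Real.pi)))) := by
      apply Continuous.aestronglyMeasurable
      apply hc.comp
      fun_prop
    rw [integrable_prod_iff' hm]
    refine ⟨Filter.Eventually.of_forall fun θ => ?_, ?_⟩
    · exact ((hmp θ).integrable_comp_emb (hemb θ)).mpr hI
    · have : (fun θ : ℝ => ∫ w : Fin n → ℂ, ‖Function.uncurry (fun (w : Fin n → ℂ) (θ : ℝ) =>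
          Φ (circleMap 0 1 θ • w)) (w, θ)‖) = fun _ => ∫ w, ‖Φ w‖ := by
        ext θ
        exact (hmp θ).integral_comp (hemb θ) (fun w => ‖Φ w‖)
      rw [this]
      exact integrable_const _
  have hpi : (0 : ℝ) ≤ 2 * Real.pi := by positivity
  simp only [intervalIntegral.integral_of_le hpi]
  refine ⟨hjoint.integral_prod_left, ?_⟩
  rw [integral_integral_swap hjoint]
  have : ∀ θ : ℝ, ∫ w : Fin n → ℂ, Φ (circleMap 0 1 θ • w) = ∫ w, Φ w := fun θ =>
    (hmp θ).integral_comp (hemb θ) Φ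
  simp only [this]
  simp [hpi]

/-- After averaging over phases, `G` on each ray is a polynomial in `r²` with constant term `G 0`.
The Laguerre weight keeps only that term, leaving `G 0` times the total Gaussian mass. -/
theorem DbarNil.integral_mul_lag {M : ℕ} (hn : 1 ≤ n) {G : (Fin n → ℂ) → ℂ}
    (hG : DbarNil (M + 1) G)
    (hI : Integrable (fun w => ‖G w‖ ^ 2 * Real.exp (-normSqSum w))) :
    ∫ w, G w * ((lag n M (normSqSum w) * Real.exp (-normSqSum w) : ℝ) : ℂ) =
      (Real.pi : ℂ) ^ n * G 0 := by
  obtain ⟨N, rfl⟩ : ∃ N, n = N + 1 := ⟨n - 1, by omega⟩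
  set P : (Fin (N + 1) → ℂ) → ℂ :=
    fun w => ((lag (N + 1) M (normSqSum w) * Real.exp (-normSqSum w) : ℝ) : ℂ) with hP
  have hGc : Continuous G := hG.contDiff.continuous
  have hPc : Continuous P := by
    have := continuous_lag (N + 1) M
    have := continuous_normSqSum (n := N + 1)
    fun_prop
  obtain ⟨h1, h2⟩ := integral_circle_average (Φ := fun w => G w * P w) (hGc.mul hPc)
    (integrable_mul_lag hGc hI (N + 1))
  have hE : ∫ w : Fin (N + 1) → ℂ, ((Real.exp (-normSqSum w) : ℝ) : ℂ) =
      (Real.pi : ℂ) ^ (N + 1) := by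
    rw [integral_complex_ofReal, integral_exp_neg_normSqSum]; push_cast; rfl
  have hEI : Integrable (fun w : Fin (N + 1) → ℂ => ((Real.exp (-normSqSum w) : ℝ) : ℂ)) := by
    have := integrable_exp_neg_mul_normSqSum (n := N + 1) one_pos
    simp only [neg_one_mul] at this
    exact this.ofReal
  have h3 : ∫ w, ∫ θ in (0 : ℝ)..2 * Real.pi, G (circleMap 0 1 θ • w) * P (circleMap 0 1 θ • w) =
      2 * Real.pi * (G 0 * (Real.pi : ℂ) ^ (N + 1)) := by
    rw [integral_polar hn h1, ← hE, integral_polar hn hEI, ← integral_const_mul, ← integral_const_mul]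
    refine integral_congr_ae (Filter.Eventually.of_forall fun x => ?_)
    have hx0 : (x : Fin (N + 1) → ℂ) ≠ 0 := ne_zero_of_mem_unit_sphere x
    obtain ⟨c, hc0, hc⟩ := hG.exists_circle_mean (x : Fin (N + 1) → ℂ)
    have hr := integral_radial_poly_mul_lag N M (normSqSum_pos hx0) c
    rw [hc0] at hr
    have hexp : 2 * (N + 1) - 1 = 2 * N + 1 := by omega
    have hn (r : ℝ) : normSqSum ((r : ℂ) • (x : Fin (N + 1) → ℂ)) =
        r ^ 2 * normSqSum (x : Fin (N + 1) → ℂ) := by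
      rw [normSqSum_smul, Complex.norm_real, Real.norm_eq_abs, sq_abs]
    simp only [hexp, hn]
    rw [← hr, ← integral_const_mul]
    refine setIntegral_congr_fun measurableSet_Ioi fun r hr => ?_
    have hPθ (θ : ℝ) : P (circleMap 0 1 θ • (r : ℂ) • (x : Fin (N + 1) → ℂ)) =
        ((lag (N + 1) M (r ^ 2 * normSqSum (x : Fin (N + 1) → ℂ)) *
          Real.exp (-(r ^ 2 * normSqSum (x : Fin (N + 1) → ℂ))) : ℝ) : ℂ) := by
      simp only [hP]
      rw [normSqSum_smul, hn]
      simp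
    have hcθ (θ : ℝ) : circleMap 0 1 θ • (r : ℂ) • (x : Fin (N + 1) → ℂ) =
        circleMap 0 r θ • (x : Fin (N + 1) → ℂ) := by
      rw [smul_smul]
      congr 1
      simp [circleMap, mul_comm]
    simp only [hPθ]
    rw [intervalIntegral.integral_mul_const]
    simp only [hcθ]
    rw [hc r hr]
    simp only [real_smul]
    ring
  rw [h3] at h2
  have hpi : (2 * Real.pi : ℂ) ≠ 0 := by
    simp [Real.pi_ne_zero]
  rw [mul_comm ((Real.pi : ℂ) ^ (N + 1))]
  exact (mul_left_cancel₀ hpi h2).symm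

/-! ### The reproducing kernel of the Fock space. -/

/-- The reproducing kernel `L_M^{(n)}(|w - z|²) exp ⟨w, z⟩` of the Fock space of
`(M + 1)`-analytic functions with weight `exp (-|z|²)`. -/
def fockKernel (M : ℕ) (z w : Fin n → ℂ) : ℂ :=
  (lag n M (normSqSum (w - z)) : ℂ) * cexp (∑ r, w r * conj (z r))

theorem ofReal_normSqSum (w : Fin n → ℂ) : (normSqSum w : ℂ) = ∑ r, w r * conj (w r) := by
  simp [normSqSum, Complex.mul_conj']

theorem differentiable_exp_linear (c : Fin n → ℂ) :
    Differentiable ℂ (fun w : Fin n → ℂ => cexp (∑ r, w r * c r)) := by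
  fun_prop

theorem contDiff_exp_linear (c : Fin n → ℂ) :
    ContDiff ℝ ∞ (fun w : Fin n → ℂ => cexp (∑ r, w r * c r)) := by
  fun_prop

/-- Each factor `|w - z|² = ∑ (w_s - z_s) conj (w_s - z_s)` raises the order by one, starting from
the holomorphic exponential. -/
theorem dbarNil_fockKernel (M : ℕ) (z : Fin n → ℂ) : DbarNil (M + 1) (fockKernel M z) := by
  have hpow (i : ℕ) : DbarNil (i + 1) (fun w : Fin n → ℂ =>
      (normSqSum (w - z) : ℂ) ^ i * cexp (∑ r, w r * conj (z r))) := by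
    induction i with
    | zero =>
      simp only [pow_zero, one_mul]
      exact dbarNil_one_of_differentiable (differentiable_exp_linear _) (contDiff_exp_linear _)
    | succ i ih =>
      have h : (fun w : Fin n → ℂ =>
          (normSqSum (w - z) : ℂ) ^ (i + 1) * cexp (∑ r, w r * conj (z r))) =
          ∑ s, (fun w : Fin n → ℂ => w s - z s) * ((fun w : Fin n → ℂ => conj (w s - z s)) *
            (fun w : Fin n → ℂ => (normSqSum (w - z) : ℂ) ^ i * cexp (∑ r, w r * conj (z r)))) := by
        ext w
        rw [pow_succ', ofReal_normSqSum]
        simp only [Finset.sum_apply, Pi.mul_apply, Pi.sub_apply, Finset.sum_mul, mul_assoc,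
          ofReal_normSqSum]
      rw [h]
      refine DbarNil.sum _ fun s _ => DbarNil.holo_mul ?_ ?_ (ih.conj_mul s (z s))
      · fun_prop
      · fun_prop
  have h : fockKernel M z = ∑ i ∈ Finset.range (M + 1), fun w : Fin n → ℂ =>
      (((-1) ^ i * ((M + n).choose (n + i) : ℝ) / (i.factorial : ℝ) : ℝ) : ℂ) *
        ((normSqSum (w - z) : ℂ) ^ i * cexp (∑ r, w r * conj (z r))) := by
    ext w
    simp only [fockKernel, lag, Finset.sum_apply]
    push_cast
    rw [Finset.sum_mul]
    refine Finset.sum_congr rfl fun i _ => ?_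
    ring
  rw [h]
  refine DbarNil.sum _ fun i hi => ((hpow i).mono ?_).const_mul _
  simp only [Finset.mem_range] at hi
  omega

theorem integrable_fockKernel_sq (M : ℕ) (z : Fin n → ℂ) :
    Integrable (fun w => ‖fockKernel M z w‖ ^ 2 * Real.exp (-normSqSum w)) := by
  refine (((integrable_lag_sq_mul_exp (n := n) n M).comp_sub_right z).const_mul
    (Real.exp (normSqSum z))).congr (Filter.Eventually.of_forall fun w => ?_)
  simp only [fockKernel, norm_mul, mul_pow, Complex.norm_real, Complex.norm_exp, Real.norm_eq_abs,
    sq_abs]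
  rw [pow_two (Real.exp _), ← Real.exp_add, mul_assoc, ← Real.exp_add, mul_left_comm,
    ← Real.exp_add]
  congr 2
  have h : ((normSqSum (w - z) : ℝ) : ℂ) = normSqSum w + normSqSum z - (∑ r, w r * conj (z r)) -
      conj (∑ r, w r * conj (z r)) := by
    simp only [ofReal_normSqSum, map_sum, ← Finset.sum_add_distrib, ← Finset.sum_sub_distrib]
    refine Finset.sum_congr rfl fun r _ => ?_
    simp only [Pi.sub_apply, map_sub, map_mul, Complex.conj_conj]
    ring
  have h2 := congrArg Complex.re h
  simp only [ofReal_re, sub_re, add_re, conj_re] at h2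
  rw [h2]; ring

/-- The Weyl translate `exp (-⟨w, z⟩) F (w + z)` stays polyanalytic and square integrable and has
value `F z` at `0`; the mean value formula for it becomes the claim after shifting `w` by `z`. -/
theorem DbarNil.integral_mul_conj_fockKernel {M : ℕ} (hn : 1 ≤ n) {F : (Fin n → ℂ) → ℂ}
    (hF : DbarNil (M + 1) F)
    (hI : Integrable (fun w => ‖F w‖ ^ 2 * Real.exp (-normSqSum w))) (z : Fin n → ℂ) :
    ∫ w, F w * conj (fockKernel M z w) * ((Real.exp (-normSqSum w) : ℝ) : ℂ) =
      (Real.pi : ℂ) ^ n * F z := by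
  set G : (Fin n → ℂ) → ℂ := fun w => cexp (∑ r, w r * (-conj (z r))) * F (w + z) with hGdef
  have hkey (w : Fin n → ℂ) : ((normSqSum (w + z) : ℝ) : ℂ) = normSqSum w + normSqSum z +
      (∑ r, w r * conj (z r)) + conj (∑ r, w r * conj (z r)) := by
    simp only [ofReal_normSqSum, map_sum, ← Finset.sum_add_distrib]
    refine Finset.sum_congr rfl fun r _ => ?_
    simp only [Pi.add_apply, map_add, map_mul, Complex.conj_conj]
    ring
  have hneg (w : Fin n → ℂ) : ∑ r, w r * (-conj (z r)) = -∑ r, w r * conj (z r) := by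
    simp [Finset.sum_neg_distrib]
  have hG : DbarNil (M + 1) G := by
    have h := hF.comp_affine 1 z
    simp only [one_smul] at h
    exact DbarNil.holo_mul (differentiable_exp_linear _) (contDiff_exp_linear _) h
  have hGI : Integrable (fun w => ‖G w‖ ^ 2 * Real.exp (-normSqSum w)) := by
    refine ((hI.comp_add_right z).const_mul (Real.exp (normSqSum z))).congr
      (Filter.Eventually.of_forall fun w => ?_)
    simp only [hGdef, norm_mul, mul_pow, Complex.norm_exp, hneg]
    rw [pow_two (Real.exp _), ← Real.exp_add, mul_right_comm, ← Real.exp_add, mul_left_comm,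
      ← Real.exp_add, mul_comm]
    congr 2
    have h2 := congrArg Complex.re (hkey w)
    simp only [ofReal_re, add_re, conj_re] at h2
    rw [h2, neg_re]; ring
  have h := hG.integral_mul_lag hn hGI
  have hG0 : G 0 = F z := by simp [hGdef]
  rw [hG0] at h
  rw [← h, ← integral_add_right_eq_self _ z]
  refine integral_congr_ae (Filter.Eventually.of_forall fun w => ?_)
  simp only [fockKernel, add_sub_cancel_right, map_mul, Complex.conj_ofReal, ← Complex.exp_conj,
    hGdef, hneg]
  have he : cexp (conj (∑ r, (w + z) r * conj (z r))) * ((Real.exp (-normSqSum (w + z)) : ℝ) : ℂ) =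
      cexp (-∑ r, w r * conj (z r)) * ((Real.exp (-normSqSum w) : ℝ) : ℂ) := by
    rw [Complex.ofReal_exp, Complex.ofReal_exp, ← Complex.exp_add, ← Complex.exp_add]
    congr 1
    have hs : conj (∑ r, (w + z) r * conj (z r)) =
        conj (∑ r, w r * conj (z r)) + normSqSum z := by
      rw [ofReal_normSqSum, map_sum, map_sum, ← Finset.sum_add_distrib]
      refine Finset.sum_congr rfl fun r _ => ?_
      simp only [Pi.add_apply, map_add, map_mul, Complex.conj_conj]
      ring
    push_cast
    rw [hs, hkey]
    ring
  push_cast at he ⊢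
  linear_combination (F (w + z) * (lag n M (normSqSum w) : ℂ)) * he

/-! ### Flattening and uniqueness of the kernel. -/

/-- The identification `(x, y) ↦ x + i y` of `ℝⁿ × ℝⁿ` with `ℂⁿ`. -/
def toComplex (p : (Fin n → ℝ) × (Fin n → ℝ)) : Fin n → ℂ :=
  fun r => (p.1 r : ℂ) + I * (p.2 r : ℂ)

theorem integral_comp_toComplex (f : (Fin n → ℂ) → ℂ) :
    ∫ p : (Fin n → ℝ) × (Fin n → ℝ), f (toComplex p) = ∫ w, f w := by
  have h1 := (volume_measurePreserving_arrowProdEquivProdArrow ℝ ℝ (Fin n)).symm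
  have h2 := volume_preserving_pi fun _ : Fin n => Complex.volume_preserving_equiv_real_prod.symm
  rw [← h2.integral_comp
    (MeasurableEquiv.piCongrRight fun _ : Fin n =>
      Complex.measurableEquivRealProd.symm).measurableEmbedding,
    ← h1.integral_comp (MeasurableEquiv.measurableEmbedding _)]
  refine integral_congr_ae (Filter.Eventually.of_forall fun p => ?_)
  dsimp only
  congr 1
  ext r
  rw [Complex.measurableEquivRealProd_symm_apply]
  simp [toComplex, Complex.ext_iff, MeasurableEquiv.arrowProdEquivProdArrow,
    Equiv.arrowProdEquivProdArrow]

/-- The factor `exp (-|x|²/2 - |y|²/2 - i⟨x,y⟩)` of the flattening operator. -/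
def flatFactor (p : (Fin n → ℝ) × (Fin n → ℝ)) : ℂ :=
  cexp (-(1 / 2 : ℂ) * ∑ r, (p.1 r : ℂ) ^ 2 - (1 / 2 : ℂ) * ∑ r, (p.2 r : ℂ) ^ 2
      - I * ∑ r, (p.1 r : ℂ) * (p.2 r : ℂ))

theorem flatFactor_mul_conj (p : (Fin n → ℝ) × (Fin n → ℝ)) :
    flatFactor p * conj (flatFactor p) = ((Real.exp (-normSqSum (toComplex p)) : ℝ) : ℂ) := by
  rw [flatFactor, ← Complex.exp_conj, ← Complex.exp_add, Complex.ofReal_exp]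
  congr 1
  push_cast
  rw [ofReal_normSqSum]
  simp only [map_sub, map_mul, map_neg, map_sum, map_pow, Complex.conj_ofReal, Complex.conj_I,
    map_div₀, map_one, Complex.conj_ofNat, toComplex, map_add]
  have : ∑ r, ((p.1 r : ℂ) + I * p.2 r) * ((p.1 r : ℂ) + -I * p.2 r) =
      ∑ r, (p.1 r : ℂ) ^ 2 + ∑ r, (p.2 r : ℂ) ^ 2 := by
    rw [← Finset.sum_add_distrib]
    refine Finset.sum_congr rfl fun r _ => ?_
    linear_combination (-(p.2 r : ℂ) ^ 2) * I_sq
  rw [this]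
  ring

theorem two_rpow_half_mul_self (n : ℕ) :
    (2 : ℝ) ^ ((n : ℝ) / 2) * (2 : ℝ) ^ ((n : ℝ) / 2) = 2 ^ n := by
  rw [← Real.rpow_add two_pos, add_halves, Real.rpow_natCast]

theorem flatten_eq (α : ℝ) (f : (Fin n → ℂ) → ℂ) (p : (Fin n → ℝ) × (Fin n → ℝ)) :
    flatten n α f p = (((2 : ℝ) ^ ((n : ℝ) / 2) : ℝ) : ℂ) * flatFactor p *
      f ((√α)⁻¹ • toComplex p) := by
  rw [flatten, flatFactor]
  congr 2
  ext r
  simp [toComplex, div_eq_inv_mul]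
  ring

/-- The reproducing kernel of the flattened space. -/
def flatKernel (M : ℕ) (p s : (Fin n → ℝ) × (Fin n → ℝ)) : ℂ :=
  (2 : ℂ) ^ n * flatFactor s * conj (flatFactor p) * fockKernel M (toComplex p) (toComplex s)

theorem fockSpace_scaled {m : ℕ} {α : ℝ} (hα : 0 < α) {f : (Fin n → ℂ) → ℂ}
    (hf : f ∈ fockSpace n m α) : DbarNil m (fun w => f ((√α)⁻¹ • w)) ∧
      Integrable (fun w => ‖f ((√α)⁻¹ • w)‖ ^ 2 * Real.exp (-normSqSum w)) := by
  have hs : √α ≠ 0 := (Real.sqrt_pos.mpr hα).ne'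
  constructor
  · simpa using (isPolyanalytic_iff_dbarNil.mp hf.1).comp_affine (√α)⁻¹ 0
  · refine (hf.2.comp_smul (inv_ne_zero hs)).congr (Filter.Eventually.of_forall fun w => ?_)
    simp only [normSqSum, Pi.smul_apply, norm_smul, mul_pow, ← Finset.mul_sum, norm_inv, inv_pow,
      Real.norm_eq_abs, sq_abs, Real.sq_sqrt hα.le]
    rw [neg_mul, ← mul_assoc, mul_inv_cancel₀ hα.ne', one_mul]

theorem flatKernel_mem_flatSpace (M : ℕ) {α : ℝ} (hα : 0 < α) (p : (Fin n → ℝ) × (Fin n → ℝ)) :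
    flatKernel M p ∈ flatSpace n (M + 1) α := by
  have hs : √α ≠ 0 := (Real.sqrt_pos.mpr hα).ne'
  refine ⟨fun z => ((((2 : ℝ) ^ ((n : ℝ) / 2) : ℝ) : ℂ) * conj (flatFactor p)) *
    fockKernel M (toComplex p) (√α • z), ⟨?_, ?_⟩, ?_⟩
  · rw [isPolyanalytic_iff_dbarNil]
    have h := (dbarNil_fockKernel M (toComplex p)).comp_affine (√α) 0
    simp only [add_zero] at h
    exact h.const_mul _
  · refine (((integrable_fockKernel_sq M (toComplex p)).comp_smul hs).const_mul
      (‖(((2 : ℝ) ^ ((n : ℝ) / 2) : ℝ) : ℂ) * conj (flatFactor p)‖ ^ 2)).congr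
      (Filter.Eventually.of_forall fun w => ?_)
    simp only [norm_mul _ (fockKernel _ _ _), mul_pow, normSqSum, Pi.smul_apply, norm_smul,
      ← Finset.mul_sum, Real.norm_eq_abs, sq_abs, Real.sq_sqrt hα.le]
    ring_nf
  · ext s
    rw [flatten_eq, flatKernel, smul_smul, mul_inv_cancel₀ hs, one_smul]
    have h : (((2 : ℝ) ^ ((n : ℝ) / 2) : ℝ) : ℂ) * (((2 : ℝ) ^ ((n : ℝ) / 2) : ℝ) : ℂ) =
        (2 : ℂ) ^ n := by
      rw [← Complex.ofReal_mul, two_rpow_half_mul_self]; push_cast; rfl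
    rw [← h]; ring

/-- The squared modulus of `flatFactor` is the Gaussian weight, and `2ⁿ πⁿ` cancels the
normalization `(2π)⁻ⁿ`. -/
theorem flatten_eq_flatInner_flatKernel (M : ℕ) (hn : 1 ≤ n) {α : ℝ} (hα : 0 < α)
    {f : (Fin n → ℂ) → ℂ} (hf : f ∈ fockSpace n (M + 1) α) (p : (Fin n → ℝ) × (Fin n → ℝ)) :
    flatten n α f p = flatInner (flatten n α f) (flatKernel M p) := by
  obtain ⟨h1, h2⟩ := fockSpace_scaled hα hf
  have h3 := h1.integral_mul_conj_fockKernel hn h2 (toComplex p)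
  rw [← integral_comp_toComplex] at h3
  have h4 (s : (Fin n → ℝ) × (Fin n → ℝ)) : flatten n α f s * conj (flatKernel M p s) =
      ((((2 : ℝ) ^ ((n : ℝ) / 2) : ℝ) : ℂ) * 2 ^ n * flatFactor p) *
      (f ((√α)⁻¹ • toComplex s) * conj (fockKernel M (toComplex p) (toComplex s)) *
        ((Real.exp (-normSqSum (toComplex s)) : ℝ) : ℂ)) := by
    rw [flatten_eq, flatKernel, ← flatFactor_mul_conj]
    simp only [map_mul, map_pow, Complex.conj_ofNat, Complex.conj_conj]
    ring
  rw [flatInner]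
  simp only [h4]
  rw [integral_const_mul, h3, flatten_eq]
  have hpi : (Real.pi : ℂ) ≠ 0 := by exact_mod_cast Real.pi_ne_zero
  push_cast
  rw [mul_pow]
  field_simp

theorem isReproducingKernel_flatKernel (M : ℕ) (hn : 1 ≤ n) {α : ℝ} (hα : 0 < α) :
    IsReproducingKernel (flatSpace n (M + 1) α) flatInner (flatKernel M) := by
  refine fun p => ⟨flatKernel_mem_flatSpace M hα p, ?_⟩
  rintro _ ⟨f, hf, rfl⟩
  exact flatten_eq_flatInner_flatKernel M hn hα hf p

theorem conj_flatInner (f g : (Fin n → ℝ) × (Fin n → ℝ) → ℂ) :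
    conj (flatInner f g) = flatInner g f := by
  rw [flatInner, flatInner, map_mul, Complex.conj_ofReal, ← integral_conj]
  simp only [map_mul, Complex.conj_conj, mul_comm]

/-- Testing each kernel on the other gives `K' y x = conj (K x y)`, and the same holds with `K' =
K`. Neither linearity nor definiteness enters. -/
theorem IsReproducingKernel.eq {X : Type*} {H : Set (X → ℂ)} {ip : (X → ℂ) → (X → ℂ) → ℂ}
    (hip : ∀ f g, conj (ip f g) = ip g f) {K K' : X → X → ℂ} (hK : IsReproducingKernel H ip K)
    (hK' : IsReproducingKernel H ip K') : K = K' := by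
  have key {K K' : X → X → ℂ} (hK : IsReproducingKernel H ip K)
      (hK' : IsReproducingKernel H ip K') (x y : X) : K' y x = conj (K x y) := by
    rw [(hK x).2 _ (hK' y).1, (hK' y).2 _ (hK x).1, hip]
  ext y x
  rw [key hK hK' x y, ← key hK hK x y]

/-! ### The horizontal Fourier transform. -/

theorem horizontalIntegrand_flatKernel {m : ℕ} (hm : 1 ≤ m) (ξ y v u : Fin n → ℝ) :
    horizontalIntegrand (flatKernel (m - 1)) ξ y v u = ∑ k ∈ multiIndices n m, (2 : ℂ) ^ n *
      ∏ r, ((Real.exp (-(1 / 2) * (v r - y r) ^ 2) : ℝ) : ℂ) *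
        (gaussWave (ξ r + v r + y r) (u r) *
          ((lag 0 (k r) ((u r) ^ 2 + (v r - y r) ^ 2) : ℝ) : ℂ)) := by
  have hsq : normSqSum (toComplex (u, v) - toComplex (0, y)) =
      ∑ r, ((u r) ^ 2 + (v r - y r) ^ 2) := by
    refine Finset.sum_congr rfl fun r _ => ?_
    rw [← Complex.normSq_eq_norm_sq, Complex.normSq_apply]
    simp [toComplex]
    ring
  -- Completing the square in `v - y` leaves a Gaussian wave in `u` of frequency `ξ + v + y`.
  have hexp : flatFactor (u, v) * conj (flatFactor (0, y)) *
      cexp (∑ r, toComplex (u, v) r * conj (toComplex (0, y) r)) *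
      cexp (-I * ∑ r, (u r : ℂ) * (ξ r : ℂ)) =
      ∏ r, ((Real.exp (-(1 / 2) * (v r - y r) ^ 2) : ℝ) : ℂ) *
        gaussWave (ξ r + v r + y r) (u r) := by
    simp only [gaussWave, Complex.ofReal_exp, ← Complex.exp_add, ← Complex.exp_sum, flatFactor,
      ← Complex.exp_conj]
    congr 1
    simp only [map_sub, map_mul, map_neg, map_sum, map_pow, Complex.conj_ofReal, Complex.conj_I,
      map_div₀, map_one, Complex.conj_ofNat, toComplex, map_add, Finset.mul_sum,
      ← Finset.sum_add_distrib, ← Finset.sum_sub_distrib]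
    refine Finset.sum_congr rfl fun r _ => ?_
    push_cast
    simp only [Pi.zero_apply, ofReal_zero]
    linear_combination (-(v r : ℂ) * (y r : ℂ)) * I_sq
  rw [horizontalIntegrand, flatKernel, fockKernel, hsq, ← sum_prod_lag n m hm]
  push_cast
  rw [Finset.sum_mul, Finset.mul_sum, Finset.sum_mul]
  refine Finset.sum_congr rfl fun k _ => ?_
  have : ∏ r, ((Real.exp (-(1 / 2) * (v r - y r) ^ 2) : ℝ) : ℂ) *
        (gaussWave (ξ r + v r + y r) (u r) *
          ((lag 0 (k r) ((u r) ^ 2 + (v r - y r) ^ 2) : ℝ) : ℂ)) =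
      (∏ r, ((Real.exp (-(1 / 2) * (v r - y r) ^ 2) : ℝ) : ℂ) *
        gaussWave (ξ r + v r + y r) (u r)) *
      ∏ r, ((lag 0 (k r) ((u r) ^ 2 + (v r - y r) ^ 2) : ℝ) : ℂ) := by
    rw [← Finset.prod_mul_distrib]
    simp only [mul_assoc]
  push_cast at this hexp
  rw [this, ← hexp]
  ring

theorem integrable_horizontalIntegrand_term (k : Fin n → ℕ) (ξ y v : Fin n → ℝ) :
    Integrable (fun u : Fin n → ℝ => (2 : ℂ) ^ n *
      ∏ r, ((Real.exp (-(1 / 2) * (v r - y r) ^ 2) : ℝ) : ℂ) *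
        (gaussWave (ξ r + v r + y r) (u r) *
          ((lag 0 (k r) ((u r) ^ 2 + (v r - y r) ^ 2) : ℝ) : ℂ))) :=
  (Integrable.fintype_prod (f := fun r (t : ℝ) =>
    ((Real.exp (-(1 / 2) * (v r - y r) ^ 2) : ℝ) : ℂ) * (gaussWave (ξ r + v r + y r) t *
          ((lag 0 (k r) (t ^ 2 + (v r - y r) ^ 2) : ℝ) : ℂ)))
    fun _ => (integrable_gaussWave_mul_lag _ _ _).const_mul _).const_mul _

/-- With `η = ξ + v + y` and `d = v - y`, the Hermite arguments `η - d` and `η + d` become `ξ + 2y`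
and `ξ + 2v`. The powers of `√(2π)` cancel, while `2ⁿ` and `√π ^ n` split evenly between the two
factors `q`. -/
theorem integral_horizontalIntegrand_term (k : Fin n → ℕ) (ξ y v : Fin n → ℝ) :
    (((2 * Real.pi) ^ (-(n : ℝ) / 2) : ℝ) : ℂ) * ∫ u : Fin n → ℝ, (2 : ℂ) ^ n *
      ∏ r, ((Real.exp (-(1 / 2) * (v r - y r) ^ 2) : ℝ) : ℂ) *
        (gaussWave (ξ r + v r + y r) (u r) *
          ((lag 0 (k r) ((u r) ^ 2 + (v r - y r) ^ 2) : ℝ) : ℂ)) = q k ξ y * q k ξ v := by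
  rw [integral_const_mul, integral_fintype_prod_volume_eq_prod (f := fun r (t : ℝ) =>
    ((Real.exp (-(1 / 2) * (v r - y r) ^ 2) : ℝ) : ℂ) * (gaussWave (ξ r + v r + y r) t *
          ((lag 0 (k r) (t ^ 2 + (v r - y r) ^ 2) : ℝ) : ℂ)))]
  have hr (r : Fin n) : ∫ t : ℝ, ((Real.exp (-(1 / 2) * (v r - y r) ^ 2) : ℝ) : ℂ) *
      (gaussWave (ξ r + v r + y r) t * ((lag 0 (k r) (t ^ 2 + (v r - y r) ^ 2) : ℝ) : ℂ)) =
      ((√(2 * Real.pi) * (√Real.pi * hermiteFun (k r) ((ξ r + 2 * y r) / √2) *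
        hermiteFun (k r) ((ξ r + 2 * v r) / √2)) : ℝ) : ℂ) := by
    have h := sqrt_pi_mul_hermiteFun_mul_hermiteFun (k r) (ξ r + v r + y r) (v r - y r)
    rw [show ξ r + v r + y r - (v r - y r) = ξ r + 2 * y r by ring,
      show ξ r + v r + y r + (v r - y r) = ξ r + 2 * v r by ring] at h
    rw [integral_const_mul, integral_gaussWave_mul_lag, h,
      show ξ r + v r + y r - (v r - y r) = ξ r + 2 * y r by ring,
      show ξ r + v r + y r + (v r - y r) = ξ r + 2 * v r by ring]
    push_cast
    ring
  simp only [hr, q]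
  have h2pi : (2 * Real.pi) ^ (-(n : ℝ) / 2) * √(2 * Real.pi) ^ n = 1 := by
    have hp : (0 : ℝ) < 2 * Real.pi := by positivity
    rw [Real.sqrt_eq_rpow, ← Real.rpow_natCast, ← Real.rpow_mul hp.le, ← Real.rpow_add hp,
      show -(n : ℝ) / 2 + 1 / 2 * n = 0 by ring, Real.rpow_zero]
  have hpi4 : Real.pi ^ ((n : ℝ) / 4) * Real.pi ^ ((n : ℝ) / 4) = √Real.pi ^ n := by
    rw [Real.sqrt_eq_rpow, ← Real.rpow_natCast, ← Real.rpow_mul Real.pi_pos.le,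
      ← Real.rpow_add Real.pi_pos]
    congr 1; ring
  rw [← Complex.ofReal_prod, ← Complex.ofReal_mul]
  have h2 : (2 : ℂ) ^ n = ((2 ^ n : ℝ) : ℂ) := by push_cast; rfl
  rw [h2, ← Complex.ofReal_mul, ← Complex.ofReal_mul]
  congr 1
  simp only [Finset.prod_mul_distrib, Finset.prod_const, Finset.card_univ, Fintype.card_fin]
  rw [← two_rpow_half_mul_self, ← hpi4]
  linear_combination ((2 : ℝ) ^ ((n : ℝ) / 2) * (2 : ℝ) ^ ((n : ℝ) / 2) *
    (Real.pi ^ ((n : ℝ) / 4) * Real.pi ^ ((n : ℝ) / 4)) *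
    (∏ r, hermiteFun (k r) ((ξ r + 2 * y r) / √2)) *
    ∏ r, hermiteFun (k r) ((ξ r + 2 * v r) / √2)) * h2pi

theorem integrable_horizontalIntegrand_flatKernel {m : ℕ} (hm : 1 ≤ m) (ξ y v : Fin n → ℝ) :
    Integrable (horizontalIntegrand (flatKernel (m - 1)) ξ y v) := by
  rw [funext (horizontalIntegrand_flatKernel hm ξ y v)]
  exact integrable_finsetSum _ fun k _ => integrable_horizontalIntegrand_term k ξ y v

theorem horizontalFourier_flatKernel {m : ℕ} (hm : 1 ≤ m) (ξ y v : Fin n → ℝ) :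
    horizontalFourier (flatKernel (m - 1)) ξ y v =
      ∑ k ∈ multiIndices n m, q k ξ y * q k ξ v := by
  rw [horizontalFourier, funext (horizontalIntegrand_flatKernel hm ξ y v),
    integral_finsetSum _ fun k _ => integrable_horizontalIntegrand_term k ξ y v, Finset.mul_sum]
  exact Finset.sum_congr rfl fun k _ => integral_horizontalIntegrand_term k ξ y v

theorem conj_q (k : Fin n → ℕ) (ξ v : Fin n → ℝ) : conj (q k ξ v) = q k ξ v :=
  Complex.conj_ofReal _

end PolyFock

end

theorem mainTheorem2 (n m : ℕ) (hn : 1 ≤ n) (hm : 1 ≤ m) (α : ℝ) (hα : 0 < α) :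
    (∃! K : (Fin n → ℝ) × (Fin n → ℝ) → (Fin n → ℝ) × (Fin n → ℝ) → ℂ,
      PolyFock.IsReproducingKernel (PolyFock.flatSpace n m α) PolyFock.flatInner K) ∧
    (∀ K : (Fin n → ℝ) × (Fin n → ℝ) → (Fin n → ℝ) × (Fin n → ℝ) → ℂ,
      PolyFock.IsReproducingKernel (PolyFock.flatSpace n m α) PolyFock.flatInner K →
      ∀ ξ y v : Fin n → ℝ,
        Integrable (PolyFock.horizontalIntegrand K ξ y v) volume ∧
        PolyFock.horizontalFourier K ξ y v =
          ∑ k ∈ PolyFock.multiIndices n m, conj (PolyFock.q k ξ y) * PolyFock.q k ξ v ∧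
        PolyFock.horizontalFourier K ξ y v =
          ∑ k ∈ PolyFock.multiIndices n m, PolyFock.q k ξ y * PolyFock.q k ξ v) ∧
    (PolyFock.multiIndices n m).card = (n + m - 1).choose n := by
  have hK := PolyFock.isReproducingKernel_flatKernel (m - 1) hn hα
  rw [Nat.sub_add_cancel hm] at hK
  refine ⟨⟨_, hK, fun K' hK' => hK'.eq PolyFock.conj_flatInner hK⟩, ?_,
    PolyFock.card_multiIndices n m hm⟩
  intro K hK' ξ y v
  rw [hK'.eq PolyFock.conj_flatInner hK]
  simp only [PolyFock.conj_q]
  exact ⟨PolyFock.integrable_horizontalIntegrand_flatKernel hm ξ y v,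
    PolyFock.horizontalFourier_flatKernel hm ξ y v, PolyFock.horizontalFourier_flatKernel hm ξ y v⟩
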